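/- For $L\ge 1$ let $Q_Lf$ be the polynomial of degree at most $L$ that interpolates $f:[0,2]\to\mathbb C$ at the nodes $1+\cos(\ell\pi/L)$, $\ell=0,\dots,L$, and for $z\in\mathbb C$ put $$I_z(f)=\int_0^2 f(s)e^{zs}\,ds,\qquad I_{L,z}(f)=\int_0^2 (Q_Lf)(s)e^{zs}\,ds.$$ For an integer $m\ge1$ let $\varrho_m(s)=(s(2-s))^{m-1/2}$ and $\|g\|_{\varrho_m}=\big(\int_0^2|g(s)|^2\varrho_m(s)\,ds\big)^{1/2}$. Let $X_m$ be the set of all continuous $f:[0,2]\to\mathbb C$ that are $m-1$ times continuously differentiable in $(0,2)$, with $f^{(m-1)}$ locally absolutely continuous in $(0,2)$ and $\|f^{(m)}\|_{\varrho_m}<\infty$. (i) For all $\mu_0>0$ and all integers $m\ge1$ there is a constant $C_{m,\mu_0}>0$ such that for all integers $L\ge\max\{1,m-1\}$, all $z\in\mathbb C$ with $\sigma:=\operatorname{Re}z\le\mu_0$ and all $f\in X_m$, $$|I_{L,z}(f)-I_z(f)|\le C_{m,\mu_0}\,L^{1-m}(1+|\sigma|)^{-3/4}\min\Big\{\frac1L,\frac{(1+|\sigma|)^{1/2}}{|z|}\Big\}\,\|f^{(m)}\|_{\varrho_m},$$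 where for $z=0$ the minimum is read as $1/L$. (ii) For all $\mu_0>0$, all integers $m$ and all real $m_0$ with $m\ge m_0>7/2$ there is a constant $C'_{m,m_0,\mu_0}>0$ such that for all integers $L\ge m-1$, all $z\in\mathbb C$ with $\sigma:=\operatorname{Re}z\le\mu_0$ and all $f\in X_m$, $$|I_{L,z}(f)-I_z(f)|\le C'_{m,m_0,\mu_0}\,(1+|z|)^{-2}L^{m_0-m-1}\big(1+(1+|\sigma|)^{-1/2}L\big)\,\|f^{(m)}\|_{\varrho_m}.$$ -/

import Mathlib

open MeasureTheory Set

namespace ClenshawCurtis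

noncomputable section

/-- The shifted Chebyshev nodes `1 + cos (ℓ π / L)` on `[0, 2]`, for `ℓ = 0, …, L`. -/
def node (L ℓ : ℕ) : ℝ := 1 + Real.cos (ℓ * Real.pi / L)

/-- The polynomial `Q_L f` of degree at most `L` that interpolates `f` at the `L + 1` shifted
Chebyshev nodes (for `L ≥ 1`). -/
def interp (L : ℕ) (f : ℝ → ℂ) : Polynomial ℂ :=
  Lagrange.interpolate (Finset.range (L + 1)) (fun ℓ => (node L ℓ : ℂ)) (fun ℓ => f (node L ℓ))

/-- `I_z(f) = ∫₀² f(s) exp(s z) ds`. -/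
def exactInt (z : ℂ) (f : ℝ → ℂ) : ℂ :=
  ∫ s in (0 : ℝ)..2, f s * Complex.exp (s * z)

/-- The product Clenshaw–Curtis rule `I_{L,z}(f) = ∫₀² (Q_L f)(s) exp(s z) ds`. -/
def rule (L : ℕ) (z : ℂ) (f : ℝ → ℂ) : ℂ :=
  ∫ s in (0 : ℝ)..2, (interp L f).eval (s : ℂ) * Complex.exp (s * z)

/-- The weight `ϱ_m(s) = (s (2 - s))^(m - 1/2)`, used for `0 < s < 2`. -/
def weight (m : ℕ) (s : ℝ) : ℝ := (s * (2 - s)) ^ ((m : ℝ) - 1 / 2)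

/-- The weighted norm `‖g‖_{ϱ_m} = (∫₀² |g(s)|² ϱ_m(s) ds)^(1/2)`
(meaningful when the integrand is integrable). -/
def weightedNorm (m : ℕ) (g : ℝ → ℂ) : ℝ :=
  Real.sqrt (∫ s in Ioo (0 : ℝ) 2, ‖g s‖ ^ 2 * weight m s)

/-- The functions for which `‖f^(m)‖_{ϱ_m}` makes sense and is finite (`m ≥ 1`): `f` is continuous
on `[0, 2]`, it is `m - 1` times continuously differentiable in `(0, 2)` with `f^(m-1)` locally
absolutely continuous there, so that `f^(m)` exists almost everywhere (and is the `m`-th weak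
derivative of `f`), and `|f^(m)|² ϱ_m` is integrable over `(0, 2)`. Nothing is required of the
derivatives at the endpoints. -/
structure IsAdmissible (m : ℕ) (f : ℝ → ℂ) : Prop where
  continuousOn : ContinuousOn f (Icc 0 2)
  contDiffOn : ContDiffOn ℝ ((m - 1 : ℕ) : WithTop ℕ∞) f (Ioo 0 2)
  absCont : ∀ a b : ℝ, 0 < a → a ≤ b → b < 2 →
    AbsolutelyContinuousOnInterval (iteratedDeriv (m - 1) f) a b
  integrable : IntegrableOn (fun s => ‖iteratedDeriv m f s‖ ^ 2 * weight m s) (Ioo 0 2)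

end

end ClenshawCurtis

namespace ClenshawCurtis

open Polynomial

noncomputable section

/-! ### Chebyshev expansions and weighted orthogonality -/

/-- The bilinear form `∫₀^π p(cos θ) q(cos θ) sin^{2m} θ dθ`. -/
def gegenbauerForm (m : ℕ) (p q : ℂ[X]) : ℂ :=
  ∫ θ in (0 : ℝ)..Real.pi,
    p.eval (Real.cos θ : ℂ) * q.eval (Real.cos θ : ℂ) * (Real.sin θ : ℂ) ^ (2 * m)

lemma continuous_eval_cos (p : ℂ[X]) : Continuous fun θ : ℝ => p.eval (Real.cos θ : ℂ) :=
  p.continuous.comp (Complex.continuous_ofReal.comp Real.continuous_cos)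

lemma continuous_ofReal_sin : Continuous fun θ : ℝ => (Real.sin θ : ℂ) :=
  Complex.continuous_ofReal.comp Real.continuous_sin

lemma hasDerivAt_eval_cos (p : ℂ[X]) (θ : ℝ) :
    HasDerivAt (fun θ : ℝ => p.eval (Real.cos θ : ℂ))
      (-(derivative p).eval (Real.cos θ : ℂ) * (Real.sin θ : ℂ)) θ := by
  have h1 : HasDerivAt (fun θ : ℝ => (Real.cos θ : ℂ)) ((-Real.sin θ : ℝ) : ℂ) θ :=
    (Real.hasDerivAt_cos θ).ofReal_comp
  have h2 := (p.hasDerivAt (Real.cos θ : ℂ)).comp θ h1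
  simpa [Function.comp_def] using h2

lemma gegenbauerForm_succ_derivative (m n : ℕ) (p : ℂ[X]) :
    gegenbauerForm (m + 1) (derivative p) (derivative^[m + 1] (Chebyshev.T ℂ n)) =
      ((n : ℂ) ^ 2 - (m : ℂ) ^ 2) * gegenbauerForm m p (derivative^[m] (Chebyshev.T ℂ n)) := by
  set q := derivative^[m] (Chebyshev.T ℂ n) with hq
  have hq1 : derivative^[m + 1] (Chebyshev.T ℂ n) = derivative q := by
    rw [hq, Function.iterate_succ_apply']
  have hq2 : derivative^[m + 2] (Chebyshev.T ℂ n) = derivative (derivative q) := by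
    rw [hq, Function.iterate_succ_apply', Function.iterate_succ_apply']
  rw [hq1]
  have hode : ∀ x : ℂ, (1 - x ^ 2) * (derivative (derivative q)).eval x =
      (2 * m + 1) * x * (derivative q).eval x - ((n : ℂ) ^ 2 - (m : ℂ) ^ 2) * q.eval x := by
    intro x
    have := Chebyshev.one_sub_X_sq_mul_iterate_derivative_T_eval (R := ℂ) n m x
    rw [hq1, hq2, ← hq] at this
    simpa using this
  set F : ℝ → ℂ := fun θ => p.eval (Real.cos θ : ℂ) *
    ((derivative q).eval (Real.cos θ : ℂ) * (Real.sin θ : ℂ) ^ (2 * m + 1)) with hF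
  set F' : ℝ → ℂ := fun θ =>
    ((n : ℂ) ^ 2 - (m : ℂ) ^ 2) * (p.eval (Real.cos θ : ℂ) * q.eval (Real.cos θ : ℂ)
      * (Real.sin θ : ℂ) ^ (2 * m)) -
    (derivative p).eval (Real.cos θ : ℂ) * (derivative q).eval (Real.cos θ : ℂ)
      * (Real.sin θ : ℂ) ^ (2 * (m + 1)) with hF'
  have hder : ∀ θ, HasDerivAt F (F' θ) θ := by
    intro θ
    have hs : HasDerivAt (fun θ : ℝ => (Real.sin θ : ℂ)) ((Real.cos θ : ℝ) : ℂ) θ :=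
      (Real.hasDerivAt_sin θ).ofReal_comp
    have := (hasDerivAt_eval_cos p θ).mul
      ((hasDerivAt_eval_cos (derivative q) θ).mul (hs.pow (2 * m + 1)))
    refine this.congr_deriv ?_
    have ho := hode (Real.cos θ)
    have hsc : (Real.sin θ : ℂ) ^ 2 = 1 - (Real.cos θ : ℂ) ^ 2 := by
      have := Real.sin_sq θ
      exact_mod_cast congrArg Complex.ofReal this
    rw [← hsc] at ho
    simp only [hF', Pi.mul_apply, Pi.pow_apply]
    push_cast
    push_cast at ho
    rw [mul_add, pow_add, pow_succ, pow_mul]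
    linear_combination (-(eval (Complex.cos θ) p) * ((Complex.sin θ) ^ 2) ^ m) * ho
  have hp := continuous_eval_cos p
  have hp' := continuous_eval_cos (derivative p)
  have hqc := continuous_eval_cos q
  have hqc' := continuous_eval_cos (derivative q)
  have hsc := continuous_ofReal_sin
  have hint : ∫ θ in (0 : ℝ)..Real.pi, F' θ = F Real.pi - F 0 :=
    intervalIntegral.integral_eq_sub_of_hasDerivAt (fun θ _ => hder θ)
      (Continuous.intervalIntegrable (by fun_prop) _ _)
  have h0 : F Real.pi - F 0 = 0 := by simp [hF]
  rw [h0, hF', intervalIntegral.integral_sub (Continuous.intervalIntegrable (by fun_prop) _ _)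
    (Continuous.intervalIntegrable (by fun_prop) _ _),
    intervalIntegral.integral_const_mul] at hint
  exact (sub_eq_zero.mp hint).symm

lemma gegenbauerForm_iterate_derivative (m n : ℕ) (p : ℂ[X]) :
    gegenbauerForm m (derivative^[m] p) (derivative^[m] (Chebyshev.T ℂ n)) =
      (∏ j ∈ Finset.range m, ((n : ℂ) ^ 2 - (j : ℂ) ^ 2)) *
        gegenbauerForm 0 p (Chebyshev.T ℂ n) := by
  induction m with
  | zero => simp
  | succ m ih =>
    rw [Function.iterate_succ_apply' derivative m p, gegenbauerForm_succ_derivative, ih,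
      Finset.prod_range_succ]
    ring

/-- The squared norm of the Chebyshev polynomial `T_n` for the Chebyshev weight. -/
def chebNormSq (n : ℕ) : ℝ := if n = 0 then Real.pi else Real.pi / 2

lemma chebNormSq_le (n : ℕ) : chebNormSq n ≤ Real.pi := by
  unfold chebNormSq; split_ifs <;> linarith [Real.pi_pos]

lemma le_chebNormSq (n : ℕ) : Real.pi / 2 ≤ chebNormSq n := by
  unfold chebNormSq; split_ifs <;> linarith [Real.pi_pos]

lemma gegenbauerForm_zero_T_T (k n : ℕ) :
    gegenbauerForm 0 (Chebyshev.T ℂ k) (Chebyshev.T ℂ n) =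
      if k = n then (chebNormSq n : ℂ) else 0 := by
  have h : gegenbauerForm 0 (Chebyshev.T ℂ k) (Chebyshev.T ℂ n) =
      ((∫ x, (Chebyshev.T ℝ k).eval x * (Chebyshev.T ℝ n).eval x ∂Chebyshev.measureT : ℝ) : ℂ) := by
    rw [Chebyshev.integral_measureT_eq_integral_cos, ← intervalIntegral.integral_ofReal]
    simp only [gegenbauerForm, mul_zero, pow_zero, mul_one]
    refine intervalIntegral.integral_congr fun θ _ => ?_
    simp only [← Chebyshev.complex_ofReal_eval_T]
    push_cast
    rfl
  rw [h]
  split_ifs with hkn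
  · subst hkn
    by_cases hk : k = 0
    · subst hk
      simpa [chebNormSq] using Chebyshev.integral_eval_T_real_mul_self_measureT_zero
    · rw [Chebyshev.integral_T_real_mul_self_measureT_of_ne_zero hk]
      simp [chebNormSq, hk]
  · rw [Chebyshev.integral_eval_T_real_mul_eval_T_real_measureT_of_ne hkn]
    simp

lemma gegenbauerForm_sum_left {ι : Type*} (m : ℕ) (s : Finset ι) (a : ι → ℂ) (p : ι → ℂ[X])
    (q : ℂ[X]) :
    gegenbauerForm m (∑ i ∈ s, C (a i) * p i) q = ∑ i ∈ s, a i * gegenbauerForm m (p i) q := by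
  have hq := continuous_eval_cos q
  have hs := continuous_ofReal_sin
  simp only [gegenbauerForm]
  simp_rw [← intervalIntegral.integral_const_mul]
  rw [← intervalIntegral.integral_finsetSum]
  · refine intervalIntegral.integral_congr fun θ _ => ?_
    simp only [eval_finsetSum, eval_mul, eval_C, Finset.sum_mul]
    exact Finset.sum_congr rfl fun i _ => by ring
  · intro i _
    have hp := continuous_eval_cos (p i)
    exact Continuous.intervalIntegrable (by fun_prop) _ _

lemma gegenbauerForm_comm (m : ℕ) (p q : ℂ[X]) : gegenbauerForm m p q = gegenbauerForm m q p := by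
  simp only [gegenbauerForm]
  exact intervalIntegral.integral_congr fun θ _ => by ring

lemma iterate_derivative_sum_C_mul {ι : Type*} (m : ℕ) (s : Finset ι) (a : ι → ℂ)
    (p : ι → ℂ[X]) :
    derivative^[m] (∑ i ∈ s, C (a i) * p i) = ∑ i ∈ s, C (a i) * derivative^[m] (p i) := by
  rw [Polynomial.iterate_derivative_sum]
  exact Finset.sum_congr rfl fun i _ => Polynomial.iterate_derivative_C_mul _ _ _

/-- The finite Chebyshev series with coefficients `a` over the index set `s`. -/
def chebSum (s : Finset ℕ) (a : ℕ → ℂ) : ℂ[X] := ∑ n ∈ s, C (a n) * Chebyshev.T ℂ n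

lemma star_eval_chebSum_iterate_derivative (m : ℕ) (s : Finset ℕ) (a : ℕ → ℂ) (x : ℝ) :
    star ((derivative^[m] (chebSum s a)).eval (x : ℂ)) =
      (derivative^[m] (chebSum s (fun n => star (a n)))).eval (x : ℂ) := by
  have h1 : chebSum s (fun n => star (a n)) = (chebSum s a).map (starRingEnd ℂ) := by
    simp [chebSum, Polynomial.map_sum]
  rw [h1, Polynomial.iterate_derivative_map, Polynomial.eval_map]
  change starRingEnd ℂ (eval₂ (RingHom.id ℂ) (x : ℂ) _) = _
  rw [Polynomial.hom_eval₂, RingHom.comp_id, Complex.conj_ofReal]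

/-- **Parseval identity** for the `m`-th derivative of a finite Chebyshev series. -/
lemma integral_norm_sq_iterate_derivative_chebSum (m : ℕ) (s : Finset ℕ) (a : ℕ → ℂ) :
    ∫ θ in (0 : ℝ)..Real.pi,
        ‖(derivative^[m] (chebSum s a)).eval (Real.cos θ : ℂ)‖ ^ 2 * Real.sin θ ^ (2 * m) =
      ∑ n ∈ s, ‖a n‖ ^ 2 *
        ((∏ j ∈ Finset.range m, ((n : ℝ) ^ 2 - (j : ℝ) ^ 2)) * chebNormSq n) := by
  have h1 : ((∫ θ in (0 : ℝ)..Real.pi, ‖(derivative^[m] (chebSum s a)).eval (Real.cos θ : ℂ)‖ ^ 2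
      * Real.sin θ ^ (2 * m) : ℝ) : ℂ) =
      gegenbauerForm m (derivative^[m] (chebSum s (fun n => star (a n))))
        (derivative^[m] (chebSum s a)) := by
    rw [← intervalIntegral.integral_ofReal, gegenbauerForm]
    refine intervalIntegral.integral_congr fun θ _ => ?_
    simp only [← star_eval_chebSum_iterate_derivative]
    push_cast
    rw [← Complex.conj_mul']
    rfl
  have h2 : gegenbauerForm m (derivative^[m] (chebSum s (fun n => star (a n))))
        (derivative^[m] (chebSum s a)) = ((∑ n ∈ s, ‖a n‖ ^ 2 *
        ((∏ j ∈ Finset.range m, ((n : ℝ) ^ 2 - (j : ℝ) ^ 2)) * chebNormSq n) : ℝ) : ℂ) := by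
    conv_lhs => rw [gegenbauerForm_comm, chebSum, iterate_derivative_sum_C_mul]
    rw [gegenbauerForm_sum_left]
    push_cast
    refine Finset.sum_congr rfl fun n hn => ?_
    rw [gegenbauerForm_comm, gegenbauerForm_iterate_derivative, chebSum, gegenbauerForm_sum_left]
    simp only [gegenbauerForm_zero_T_T, mul_ite, mul_zero, Finset.sum_ite_eq', hn, if_true]
    rw [← Complex.conj_mul']
    simp only [Complex.star_def]
    ring
  exact_mod_cast h1.trans h2

lemma exists_eq_chebSum (p : ℂ[X]) : ∃ (N : ℕ) (a : ℕ → ℂ), p = chebSum (Finset.range N) a := by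
  have hspan : p ∈ Submodule.span ℂ (range fun n : ℕ => Chebyshev.T ℂ (n : ℤ)) := by
    set S := Submodule.span ℂ (range fun n : ℕ => Chebyshev.T ℂ (n : ℤ)) with hS
    have hT : ∀ n : ℕ, Chebyshev.T ℂ (n : ℤ) ∈ S := fun n => Submodule.subset_span ⟨n, rfl⟩
    have hTz : ∀ n : ℤ, Chebyshev.T ℂ n ∈ S := fun n => by
      rw [← Chebyshev.T_natAbs]; exact hT _
    have hX : ∀ q ∈ S, X * q ∈ S := by
      intro q hq
      induction hq using Submodule.span_induction with
      | mem x hx =>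
        obtain ⟨n, rfl⟩ := hx
        have h := Chebyshev.T_add_one ℂ n
        have : X * Chebyshev.T ℂ (n : ℤ) = (1 / 2 : ℂ) •
            (Chebyshev.T ℂ ((n : ℤ) + 1) + Chebyshev.T ℂ ((n : ℤ) - 1)) := by
          rw [h, sub_add_cancel, mul_assoc, show (2 : ℂ[X]) = C 2 from rfl, ← smul_eq_C_mul,
            smul_smul]
          norm_num
        simp only [this]
        exact S.smul_mem _ (S.add_mem (hTz _) (hTz _))
      | zero => simp
      | add x y _ _ hx hy => rw [mul_add]; exact S.add_mem hx hy
      | smul c x _ hx => rw [mul_smul_comm]; exact S.smul_mem _ hx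
    have hXn : ∀ n : ℕ, (X : ℂ[X]) ^ n ∈ S := by
      intro n
      induction n with
      | zero => simpa using hTz 0
      | succ n ih => rw [pow_succ']; exact hX _ ih
    rw [p.as_sum_range_C_mul_X_pow]
    refine S.sum_mem fun i _ => ?_
    rw [← smul_eq_C_mul]
    exact S.smul_mem _ (hXn i)
  obtain ⟨c, hc⟩ := (Finsupp.mem_span_range_iff_exists_finsupp).mp hspan
  refine ⟨c.support.sup id + 1, c, ?_⟩
  rw [← hc, chebSum, Finsupp.sum]
  simp only [smul_eq_C_mul]
  refine Finset.sum_subset (fun n hn => ?_) fun n _ hn => by simp [Finsupp.notMem_support_iff.mp hn]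
  exact Finset.mem_range.mpr (Nat.lt_succ_of_le (Finset.le_sup (f := id) hn))

lemma prod_sq_sub_sq_nonneg (m n : ℕ) :
    0 ≤ ∏ j ∈ Finset.range m, ((n : ℝ) ^ 2 - (j : ℝ) ^ 2) := by
  rcases le_or_gt m n with h | h
  · refine Finset.prod_nonneg fun j hj => ?_
    have : (j : ℝ) ≤ n := by exact_mod_cast (Finset.mem_range.mp hj).le.trans h
    nlinarith [(Nat.cast_nonneg j : (0 : ℝ) ≤ j)]
  · rw [Finset.prod_eq_zero (Finset.mem_range.mpr h) (by ring)]

lemma pow_le_mul_prod_sq_sub_sq {m n : ℕ} (hmn : m ≤ n) :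
    (n : ℝ) ^ (2 * m) ≤ (m : ℝ) ^ m * ∏ j ∈ Finset.range m, ((n : ℝ) ^ 2 - (j : ℝ) ^ 2) := by
  have hm : (m : ℝ) ^ m = ∏ _j ∈ Finset.range m, (m : ℝ) := by simp
  have hn : (n : ℝ) ^ (2 * m) = ∏ _j ∈ Finset.range m, (n : ℝ) ^ 2 := by simp [pow_mul]
  rw [hm, hn, ← Finset.prod_mul_distrib]
  refine Finset.prod_le_prod (fun j _ => by positivity) fun j hj => ?_
  have hj' : (j : ℝ) + 1 ≤ m := by exact_mod_cast Finset.mem_range.mp hj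
  have hmn' : (m : ℝ) ≤ n := by exact_mod_cast hmn
  have h0 : (0 : ℝ) ≤ j := Nat.cast_nonneg j
  have h1 : (j : ℝ) ^ 2 * m ≤ (m - 1) * n ^ 2 := by
    have : (j : ℝ) * m ≤ (m - 1) * n := by nlinarith
    nlinarith
  nlinarith

/-- Control of the high Chebyshev coefficients by the weighted norm of the `m`-th derivative. -/
lemma sum_pow_mul_norm_sq_le (m : ℕ) (s : Finset ℕ) (a : ℕ → ℂ) :
    ∑ n ∈ s with m ≤ n, (n : ℝ) ^ (2 * m) * ‖a n‖ ^ 2 ≤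
      (m : ℝ) ^ m * ∫ θ in (0 : ℝ)..Real.pi,
        ‖(derivative^[m] (chebSum s a)).eval (Real.cos θ : ℂ)‖ ^ 2 * Real.sin θ ^ (2 * m) := by
  rw [integral_norm_sq_iterate_derivative_chebSum, Finset.mul_sum]
  have hπ : 1 ≤ Real.pi / 2 := by linarith [Real.pi_gt_three]
  have hnn : ∀ n, 0 ≤ ‖a n‖ ^ 2 *
      ((∏ j ∈ Finset.range m, ((n : ℝ) ^ 2 - (j : ℝ) ^ 2)) * chebNormSq n) := fun n =>
    mul_nonneg (by positivity) (mul_nonneg (prod_sq_sub_sq_nonneg m n)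
      (by linarith [le_chebNormSq n]))
  refine (Finset.sum_le_sum fun n hn => ?_).trans (Finset.sum_le_sum_of_subset_of_nonneg
    (Finset.filter_subset _ s) fun n _ _ => mul_nonneg (by positivity) (hnn n))
  have h1 := pow_le_mul_prod_sq_sub_sq (Finset.mem_filter.mp hn).2
  have h2 := prod_sq_sub_sq_nonneg m n
  have h3 : (1 : ℝ) ≤ chebNormSq n := hπ.trans (le_chebNormSq n)
  have h4 := mul_le_mul_of_nonneg_left h3
    (mul_nonneg (by positivity : (0 : ℝ) ≤ (m : ℝ) ^ m) h2)
  calc (n : ℝ) ^ (2 * m) * ‖a n‖ ^ 2 ≤ (((m : ℝ) ^ m * ∏ j ∈ Finset.range m,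
        ((n : ℝ) ^ 2 - (j : ℝ) ^ 2)) * chebNormSq n) * ‖a n‖ ^ 2 := by
        gcongr
        linarith
    _ = _ := by ring

/-! ### Aliasing at the Chebyshev nodes -/

/-- The index `k ≤ L` such that `T_n` and `T_k` agree at the points `cos (ℓ π / L)`. -/
def aliasIndex (L n : ℕ) : ℕ := if Even (n / L) then n % L else L - n % L

lemma aliasIndex_le {L : ℕ} (hL : 0 < L) (n : ℕ) : aliasIndex L n ≤ L := by
  unfold aliasIndex
  have := Nat.mod_lt n hL
  split_ifs <;> omega

lemma aliasIndex_of_le {L n : ℕ} (hL : 0 < L) (h : n ≤ L) : aliasIndex L n = n := by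
  unfold aliasIndex
  rcases h.lt_or_eq with h | rfl
  · simp [Nat.div_eq_of_lt h, Nat.mod_eq_of_lt h]
  · simp [Nat.div_self hL]

lemma aliasIndex_injOn {L : ℕ} {n n' : ℕ} (hL : 0 < L)
    (h : aliasIndex L n = aliasIndex L n') (hq : n / L = n' / L) : n = n' := by
  unfold aliasIndex at h
  rw [hq] at h
  have h1 := Nat.div_add_mod n L
  have h2 := Nat.div_add_mod n' L
  have h3 := Nat.mod_lt n hL
  have h4 := Nat.mod_lt n' hL
  rw [hq] at h1
  split_ifs at h <;> omega

lemma cos_mul_aliasIndex {L : ℕ} (hL : 0 < L) (n ℓ : ℕ) :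
    Real.cos (n * (ℓ * Real.pi / L)) = Real.cos (aliasIndex L n * (ℓ * Real.pi / L)) := by
  have hL' : (L : ℝ) ≠ 0 := by exact_mod_cast hL.ne'
  have hn : (n : ℝ) = L * (n / L : ℕ) + (n % L : ℕ) := by exact_mod_cast (Nat.div_add_mod n L).symm
  unfold aliasIndex
  split_ifs with h
  · obtain ⟨j, hj⟩ := h
    have : (n : ℝ) * (ℓ * Real.pi / L) =
        ((n % L : ℕ) : ℝ) * (ℓ * Real.pi / L) + ((j * ℓ : ℕ) : ℝ) * (2 * Real.pi) := by
      rw [hn, hj]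
      field_simp
      push_cast
      ring
    rw [this, Real.cos_add_nat_mul_two_pi]
  · obtain ⟨j, hj⟩ := Nat.not_even_iff_odd.mp h
    have : (n : ℝ) * (ℓ * Real.pi / L) =
        (((j + 1) * ℓ : ℕ) : ℝ) * (2 * Real.pi) -
          ((L - n % L : ℕ) : ℝ) * (ℓ * Real.pi / L) := by
      rw [Nat.cast_sub (Nat.mod_lt n hL).le, hn, hj]
      field_simp
      push_cast
      ring
    rw [this, Real.cos_nat_mul_two_pi_sub]

lemma eval_T_aliasIndex {L : ℕ} (hL : 0 < L) (n ℓ : ℕ) :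
    (Chebyshev.T ℂ n).eval (Real.cos (ℓ * Real.pi / L) : ℂ) =
      (Chebyshev.T ℂ (aliasIndex L n)).eval (Real.cos (ℓ * Real.pi / L) : ℂ) := by
  rw [← Chebyshev.complex_ofReal_eval_T, ← Chebyshev.complex_ofReal_eval_T, Chebyshev.T_real_cos,
    Chebyshev.T_real_cos]
  exact_mod_cast congrArg Complex.ofReal (cos_mul_aliasIndex hL n ℓ)

/-- The interpolant of a finite Chebyshev series, as a polynomial in `x = s - 1`. -/
def aliasSum (L : ℕ) (s : Finset ℕ) (a : ℕ → ℂ) : ℂ[X] :=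
  ∑ n ∈ s, C (a n) * Chebyshev.T ℂ (aliasIndex L n)

lemma node_injOn (L : ℕ) :
    Set.InjOn (fun ℓ => (node L ℓ : ℂ)) (Finset.range (L + 1) : Set ℕ) := by
  rcases Nat.eq_zero_or_pos L with rfl | hL
  · intro i hi j hj _
    simp at hi hj
    omega
  have hL' : (0 : ℝ) < L := by exact_mod_cast hL
  intro i hi j hj h
  have hmem : ∀ k ∈ (Finset.range (L + 1) : Set ℕ), (k * Real.pi / L : ℝ) ∈ Icc 0 Real.pi := by
    intro k hk
    have hk' : (k : ℝ) ≤ L := by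
      exact_mod_cast Nat.lt_succ_iff.mp (by simpa using hk)
    refine ⟨by positivity, ?_⟩
    rw [div_le_iff₀ hL', mul_comm]
    exact mul_le_mul_of_nonneg_left hk' Real.pi_pos.le
  have h' : node L i = node L j := Complex.ofReal_injective h
  have h2 := Real.injOn_cos (hmem i hi) (hmem j hj) (by simpa [node] using h')
  have h3 : (i : ℝ) = j := by field_simp at h2; exact h2
  exact_mod_cast h3

lemma interp_chebSum {L : ℕ} (hL : 0 < L) (s : Finset ℕ) (a : ℕ → ℂ) :
    interp L (fun x : ℝ => ((chebSum s a).comp (X - C 1)).eval (x : ℂ)) =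
      (aliasSum L s a).comp (X - C 1) := by
  symm
  unfold interp
  refine Lagrange.eq_interpolate_of_eval_eq _ (node_injOn L) ?_ ?_
  · rw [Finset.card_range]
    have h1 : (aliasSum L s a).natDegree ≤ L := by
      refine Polynomial.natDegree_sum_le_of_forall_le s _ fun n _ => ?_
      refine (Polynomial.natDegree_C_mul_le _ _).trans ?_
      rw [Chebyshev.natDegree_T]
      simpa using aliasIndex_le hL n
    have h2 : ((aliasSum L s a).comp (X - C 1)).natDegree ≤ L := by
      rw [Polynomial.natDegree_comp, Polynomial.natDegree_X_sub_C, mul_one]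
      exact h1
    exact (Polynomial.degree_le_of_natDegree_le h2).trans_lt (by exact_mod_cast Nat.lt_succ_self L)
  · intro ℓ _
    have : ((node L ℓ : ℝ) : ℂ) - 1 = (Real.cos (ℓ * Real.pi / L) : ℂ) := by
      simp [node]
    simp only [eval_comp, eval_sub, eval_X, eval_C, this, aliasSum, chebSum, eval_finsetSum,
      eval_mul]
    exact Finset.sum_congr rfl fun n _ => by rw [eval_T_aliasIndex hL n ℓ]

/-- The integral of `q(s - 1) exp(s z)` over `[0, 2]` in the variable `s = 1 + cos θ`. -/
def cosInt (z : ℂ) (q : ℂ[X]) : ℂ :=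
  ∫ θ in (0 : ℝ)..Real.pi,
    q.eval (Real.cos θ : ℂ) * Complex.exp ((1 + Real.cos θ : ℝ) * z) * (Real.sin θ : ℂ)

lemma continuous_exp_cos (z : ℂ) :
    Continuous fun θ : ℝ => Complex.exp ((1 + Real.cos θ : ℝ) * z) := by fun_prop

lemma integral_comp_sub_one_mul_exp (z : ℂ) (q : ℂ[X]) :
    ∫ s in (0 : ℝ)..2, (q.comp (X - C 1)).eval (s : ℂ) * Complex.exp (s * z) = cosInt z q := by
  set g : ℝ → ℂ := fun s => (q.comp (X - C 1)).eval (s : ℂ) * Complex.exp (s * z) with hg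
  have hgc : Continuous g := by
    have := (q.comp (X - C 1)).continuous.comp Complex.continuous_ofReal
    have h2 : Continuous fun s : ℝ => Complex.exp (s * z) := by fun_prop
    exact this.mul h2
  have h := intervalIntegral.integral_deriv_smul_comp (a := 0) (b := Real.pi)
    (f := fun θ => 1 + Real.cos θ) (f' := fun θ => -Real.sin θ) (g := g)
    (fun θ _ => by simpa using (Real.hasDerivAt_cos θ).const_add 1)
    (by fun_prop) hgc
  simp only [Real.cos_zero, Real.cos_pi] at h
  norm_num at h
  rw [intervalIntegral.integral_symm 0 2, neg_inj] at h
  rw [← h, cosInt]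
  refine intervalIntegral.integral_congr fun θ _ => ?_
  simp only [hg, eval_comp, eval_sub, eval_X, eval_C]
  push_cast
  ring_nf

lemma cosInt_sub (z : ℂ) (p q : ℂ[X]) : cosInt z (p - q) = cosInt z p - cosInt z q := by
  have hp := continuous_eval_cos p
  have hq := continuous_eval_cos q
  have hs := continuous_ofReal_sin
  have he := continuous_exp_cos z
  unfold cosInt
  rw [← intervalIntegral.integral_sub (Continuous.intervalIntegrable (by fun_prop) _ _)
    (Continuous.intervalIntegrable (by fun_prop) _ _)]
  exact intervalIntegral.integral_congr fun θ _ => by simp only [eval_sub]; ring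

lemma cosInt_sum {ι : Type*} (z : ℂ) (s : Finset ι) (a : ι → ℂ) (p : ι → ℂ[X]) :
    cosInt z (∑ i ∈ s, C (a i) * p i) = ∑ i ∈ s, a i * cosInt z (p i) := by
  have hs := continuous_ofReal_sin
  have he := continuous_exp_cos z
  unfold cosInt
  simp_rw [← intervalIntegral.integral_const_mul]
  rw [← intervalIntegral.integral_finsetSum]
  · refine intervalIntegral.integral_congr fun θ _ => ?_
    simp only [eval_finsetSum, eval_mul, eval_C, Finset.sum_mul]
    exact Finset.sum_congr rfl fun i _ => by ring
  · intro i _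
    have hp := continuous_eval_cos (p i)
    exact Continuous.intervalIntegrable (by fun_prop) _ _

/-- Integration by parts. -/
lemma mul_cosInt (z : ℂ) (q : ℂ[X]) :
    z * cosInt z q = q.eval 1 * Complex.exp (2 * z) - q.eval (-1) - cosInt z (derivative q) := by
  have hq := continuous_eval_cos q
  have hq' := continuous_eval_cos (derivative q)
  have hs := continuous_ofReal_sin
  have he := continuous_exp_cos z
  set F : ℝ → ℂ := fun θ => q.eval (Real.cos θ : ℂ) * Complex.exp ((1 + Real.cos θ : ℝ) * z)
    with hF
  have hder : ∀ θ : ℝ, HasDerivAt F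
      (-(z * (q.eval (Real.cos θ : ℂ) * Complex.exp ((1 + Real.cos θ : ℝ) * z) *
        (Real.sin θ : ℂ))) -
      (derivative q).eval (Real.cos θ : ℂ) * Complex.exp ((1 + Real.cos θ : ℝ) * z) *
        (Real.sin θ : ℂ)) θ := by
    intro θ
    have h1 : HasDerivAt (fun θ : ℝ => ((1 + Real.cos θ : ℝ) : ℂ)) ((-Real.sin θ : ℝ) : ℂ) θ := by
      exact ((Real.hasDerivAt_cos θ).const_add 1).ofReal_comp
    have h2 := (h1.mul_const z).cexp
    refine ((hasDerivAt_eval_cos q θ).mul h2).congr_deriv ?_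
    push_cast
    ring
  have hint := intervalIntegral.integral_eq_sub_of_hasDerivAt (a := 0) (b := Real.pi)
    (fun θ _ => hder θ) (Continuous.intervalIntegrable (by fun_prop) _ _)
  rw [intervalIntegral.integral_sub (Continuous.intervalIntegrable (by fun_prop) _ _)
    (Continuous.intervalIntegrable (by fun_prop) _ _), intervalIntegral.integral_neg,
    intervalIntegral.integral_const_mul] at hint
  have h0 : F Real.pi - F 0 = q.eval (-1) - q.eval 1 * Complex.exp (2 * z) := by
    simp [hF]
    norm_num
  rw [h0] at hint
  unfold cosInt
  linear_combination -hint

/-- The interpolation error of a finite Chebyshev series only involves the indices above `L`. -/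
lemma rule_sub_exactInt_chebSum {L : ℕ} (hL : 0 < L) (z : ℂ) (s : Finset ℕ) (a : ℕ → ℂ) :
    rule L z (fun x : ℝ => ((chebSum s a).comp (X - C 1)).eval (x : ℂ)) -
      exactInt z (fun x : ℝ => ((chebSum s a).comp (X - C 1)).eval (x : ℂ)) =
    cosInt z (aliasSum L (s.filter (L < ·)) a - chebSum (s.filter (L < ·)) a) := by
  rw [rule, exactInt, interp_chebSum hL, integral_comp_sub_one_mul_exp,
    integral_comp_sub_one_mul_exp, ← cosInt_sub]
  congr 1
  simp only [aliasSum, chebSum, ← Finset.sum_sub_distrib]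
  rw [Finset.sum_filter]
  refine Finset.sum_congr rfl fun n _ => ?_
  split_ifs with h
  · rfl
  · rw [aliasIndex_of_le hL (not_lt.mp h), sub_self]

lemma eval_one_aliasSum_sub (L : ℕ) (s : Finset ℕ) (a : ℕ → ℂ) :
    (aliasSum L s a - chebSum s a).eval 1 = 0 := by
  simp [aliasSum, chebSum, eval_finsetSum]

lemma eval_T_neg_one_aliasIndex {L : ℕ} (hL : 0 < L) (n : ℕ) :
    (Chebyshev.T ℂ n).eval (-1) = (Chebyshev.T ℂ (aliasIndex L n)).eval (-1) := by
  have h := eval_T_aliasIndex hL n L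
  have hL' : (L : ℝ) ≠ 0 := by exact_mod_cast hL.ne'
  rw [mul_div_cancel_left₀ _ hL', Real.cos_pi] at h
  simpa only [Complex.ofReal_neg, Complex.ofReal_one] using h

lemma eval_neg_one_aliasSum_sub {L : ℕ} (hL : 0 < L) (s : Finset ℕ) (a : ℕ → ℂ) :
    (aliasSum L s a - chebSum s a).eval (-1) = 0 := by
  simp only [aliasSum, chebSum, eval_sub, eval_finsetSum, eval_mul, eval_C]
  rw [sub_eq_zero]
  exact Finset.sum_congr rfl fun n _ => by rw [eval_T_neg_one_aliasIndex hL n]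

lemma sum_inv_pow_filter_aliasIndex_le {L m : ℕ} (hL : 0 < L) (hm : 1 ≤ m) (s : Finset ℕ)
    (hs : ∀ n ∈ s, L < n) (k : ℕ) :
    ∑ n ∈ s with aliasIndex L n = k, ((n : ℝ) ^ (2 * m))⁻¹ ≤ 2 * ((L : ℝ) ^ (2 * m))⁻¹ := by
  have hL' : (0 : ℝ) < L := by exact_mod_cast hL
  set t := s.filter (fun n => aliasIndex L n = k) with ht
  have hinj : Set.InjOn (fun n => n / L) (t : Set ℕ) := by
    intro i hi j hj hij
    have hi' := (Finset.mem_filter.mp hi).2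
    have hj' := (Finset.mem_filter.mp hj).2
    exact aliasIndex_injOn hL (hi'.trans hj'.symm) hij
  have hpos : ∀ n ∈ t, 1 ≤ n / L := fun n hn =>
    (Nat.one_le_div_iff hL).mpr (hs n (Finset.mem_filter.mp hn).1).le
  calc ∑ n ∈ t, ((n : ℝ) ^ (2 * m))⁻¹
      ≤ ∑ n ∈ t, (((n / L : ℕ) : ℝ) ^ 2)⁻¹ * ((L : ℝ) ^ (2 * m))⁻¹ := by
        refine Finset.sum_le_sum fun n hn => ?_
        have hq : (1 : ℝ) ≤ ((n / L : ℕ) : ℝ) := by exact_mod_cast hpos n hn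
        have h1 : ((n / L : ℕ) : ℝ) * L ≤ n := by exact_mod_cast Nat.div_mul_le_self n L
        rw [← mul_inv]
        refine inv_anti₀ (by positivity) ?_
        calc ((n / L : ℕ) : ℝ) ^ 2 * (L : ℝ) ^ (2 * m)
            ≤ ((n / L : ℕ) : ℝ) ^ (2 * m) * (L : ℝ) ^ (2 * m) := by
              gcongr
              omega
          _ = (((n / L : ℕ) : ℝ) * L) ^ (2 * m) := by rw [mul_pow]
          _ ≤ _ := by gcongr
    _ = (∑ q ∈ t.image (fun n => n / L), ((q : ℝ) ^ 2)⁻¹) * ((L : ℝ) ^ (2 * m))⁻¹ := by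
        rw [Finset.sum_image hinj, Finset.sum_mul]
    _ ≤ 2 * ((L : ℝ) ^ (2 * m))⁻¹ := by
        gcongr
        set u := t.image (fun n => n / L) with hu
        have hsub : u ⊆ Finset.Ioo 0 (u.sup id + 1) := by
          intro q hq
          obtain ⟨n, hn, rfl⟩ := Finset.mem_image.mp hq
          exact Finset.mem_Ioo.mpr ⟨hpos n hn, Nat.lt_succ_of_le (Finset.le_sup (f := id) hq)⟩
        refine (Finset.sum_le_sum_of_subset_of_nonneg hsub fun _ _ _ => by positivity).trans ?_
        simpa using sum_Ioo_inv_sq_le (α := ℝ) 0 (u.sup id + 1)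

lemma norm_sum_filter_aliasIndex_sq_le {L m : ℕ} (hL : 0 < L) (hm : 1 ≤ m) (s : Finset ℕ)
    (hs : ∀ n ∈ s, L < n) (a : ℕ → ℂ) (k : ℕ) :
    ‖∑ n ∈ s with aliasIndex L n = k, a n‖ ^ 2 ≤
      2 * ((L : ℝ) ^ (2 * m))⁻¹ *
        ∑ n ∈ s with aliasIndex L n = k, (n : ℝ) ^ (2 * m) * ‖a n‖ ^ 2 := by
  set t := s.filter (fun n => aliasIndex L n = k) with ht
  have h1 : ‖∑ n ∈ t, a n‖ ≤ ∑ n ∈ t, ((n : ℝ) ^ m)⁻¹ * ((n : ℝ) ^ m * ‖a n‖) := by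
    refine (norm_sum_le _ _).trans (Finset.sum_le_sum fun n hn => ?_)
    have hn : (0 : ℝ) < n := by
      exact_mod_cast (Nat.zero_le L).trans_lt (hs n (Finset.mem_filter.mp hn).1)
    rw [inv_mul_cancel_left₀ (by positivity)]
  calc ‖∑ n ∈ t, a n‖ ^ 2 ≤ (∑ n ∈ t, ((n : ℝ) ^ m)⁻¹ * ((n : ℝ) ^ m * ‖a n‖)) ^ 2 := by gcongr
    _ ≤ (∑ n ∈ t, (((n : ℝ) ^ m)⁻¹) ^ 2) * ∑ n ∈ t, ((n : ℝ) ^ m * ‖a n‖) ^ 2 :=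
        Finset.sum_mul_sq_le_sq_mul_sq _ _ _
    _ = (∑ n ∈ t, ((n : ℝ) ^ (2 * m))⁻¹) * ∑ n ∈ t, (n : ℝ) ^ (2 * m) * ‖a n‖ ^ 2 := by
        congr 1
        · exact Finset.sum_congr rfl fun n _ => by rw [inv_pow, ← pow_mul, mul_comm]
        · exact Finset.sum_congr rfl fun n _ => by rw [mul_pow, ← pow_mul, mul_comm m]
    _ ≤ _ := by
        gcongr
        exact sum_inv_pow_filter_aliasIndex_le hL hm s hs k

/-- The Chebyshev coefficients of the interpolation error of a series with indices above `L`. -/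
def errorCoeff (L : ℕ) (s : Finset ℕ) (a : ℕ → ℂ) (k : ℕ) : ℂ :=
  if k ≤ L then ∑ n ∈ s with aliasIndex L n = k, a n else -a k

lemma disjoint_range_of_lt {L : ℕ} {s : Finset ℕ} (hs : ∀ n ∈ s, L < n) :
    Disjoint (Finset.range (L + 1)) s :=
  Finset.disjoint_left.mpr fun n hn hn' => by
    have := hs n hn'
    have := Finset.mem_range.mp hn
    omega

lemma aliasSum_sub_chebSum {L : ℕ} (hL : 0 < L) {s : Finset ℕ} (hs : ∀ n ∈ s, L < n)
    (a : ℕ → ℂ) :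
    aliasSum L s a - chebSum s a = chebSum (Finset.range (L + 1) ∪ s) (errorCoeff L s a) := by
  rw [chebSum, chebSum, Finset.sum_union (disjoint_range_of_lt hs), sub_eq_add_neg,
    ← Finset.sum_neg_distrib]
  congr 1
  · rw [aliasSum, ← Finset.sum_fiberwise_of_maps_to (t := Finset.range (L + 1))
      (g := aliasIndex L) (fun n _ => Finset.mem_range.mpr (Nat.lt_succ_of_le (aliasIndex_le hL n)))]
    refine Finset.sum_congr rfl fun k hk => ?_
    rw [errorCoeff, if_pos (Nat.lt_succ_iff.mp (Finset.mem_range.mp hk)), map_sum, Finset.sum_mul]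
    exact Finset.sum_congr rfl fun n hn => by rw [(Finset.mem_filter.mp hn).2]
  · exact Finset.sum_congr rfl fun n hn => by
      rw [errorCoeff, if_neg (not_le.mpr (hs n hn)), map_neg, neg_mul]

lemma sum_pow_mul_norm_errorCoeff_sq_le {L m j : ℕ} (hL : 0 < L) (hm : 1 ≤ m) (hj : j ≤ m)
    {s : Finset ℕ} (hs : ∀ n ∈ s, L < n) (a : ℕ → ℂ) :
    ∑ n ∈ Finset.range (L + 1) ∪ s, (n : ℝ) ^ (2 * j) * ‖errorCoeff L s a n‖ ^ 2 ≤
      3 * ((L : ℝ) ^ (2 * j) * ((L : ℝ) ^ (2 * m))⁻¹) *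
        ∑ n ∈ s, (n : ℝ) ^ (2 * m) * ‖a n‖ ^ 2 := by
  have hL' : (0 : ℝ) < L := by exact_mod_cast hL
  rw [Finset.sum_union (disjoint_range_of_lt hs)]
  have h1 : ∑ k ∈ Finset.range (L + 1), (k : ℝ) ^ (2 * j) * ‖errorCoeff L s a k‖ ^ 2 ≤
      2 * ((L : ℝ) ^ (2 * j) * ((L : ℝ) ^ (2 * m))⁻¹) *
        ∑ n ∈ s, (n : ℝ) ^ (2 * m) * ‖a n‖ ^ 2 := by
    rw [← Finset.sum_fiberwise_of_maps_to (s := s) (t := Finset.range (L + 1))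
      (g := aliasIndex L) (fun n _ => Finset.mem_range.mpr (Nat.lt_succ_of_le (aliasIndex_le hL n))),
      Finset.mul_sum]
    refine Finset.sum_le_sum fun k hk => ?_
    have hk' := Nat.lt_succ_iff.mp (Finset.mem_range.mp hk)
    have hkL : (k : ℝ) ≤ L := by exact_mod_cast hk'
    rw [errorCoeff, if_pos hk']
    calc (k : ℝ) ^ (2 * j) * ‖∑ n ∈ s with aliasIndex L n = k, a n‖ ^ 2
        ≤ (L : ℝ) ^ (2 * j) * (2 * ((L : ℝ) ^ (2 * m))⁻¹ *
          ∑ n ∈ s with aliasIndex L n = k, (n : ℝ) ^ (2 * m) * ‖a n‖ ^ 2) := by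
          gcongr
          exact norm_sum_filter_aliasIndex_sq_le hL hm s hs a k
      _ = _ := by ring
  have h2 : ∑ n ∈ s, (n : ℝ) ^ (2 * j) * ‖errorCoeff L s a n‖ ^ 2 ≤
      ((L : ℝ) ^ (2 * j) * ((L : ℝ) ^ (2 * m))⁻¹) *
        ∑ n ∈ s, (n : ℝ) ^ (2 * m) * ‖a n‖ ^ 2 := by
    rw [Finset.mul_sum]
    refine Finset.sum_le_sum fun n hn => ?_
    have hLn : (L : ℝ) ≤ n := by exact_mod_cast (hs n hn).le
    rw [errorCoeff, if_neg (not_le.mpr (hs n hn)), norm_neg, ← mul_assoc]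
    gcongr
    obtain ⟨i, rfl⟩ := Nat.exists_eq_add_of_le hj
    rw [mul_add, pow_add, pow_add, mul_inv, mul_inv_cancel_left₀ (by positivity)]
    have : (1 : ℝ) ≤ ((L : ℝ) ^ (2 * i))⁻¹ * (n : ℝ) ^ (2 * i) := by
      rw [inv_mul_eq_div, one_le_div (by positivity)]
      gcongr
    nlinarith [pow_pos (hL'.trans_le hLn) (2 * j)]
  linarith

/-! ### Exponential integrals -/

lemma mul_le_sub_one_add_abs_mul {μ σ u : ℝ} (hμ : 0 < μ) (hσ : σ ≤ μ) (h0 : 0 ≤ u) (h2 : u ≤ 2) :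
    σ * u ≤ (2 + 4 * μ) - (1 + |σ|) * u := by
  rcases le_total 0 σ with h | h
  · rw [abs_of_nonneg h]
    nlinarith
  · rw [abs_of_nonpos h]
    nlinarith

lemma two_div_pi_sq_mul_le_one_add_cos {θ : ℝ} (h0 : 0 ≤ θ) (h1 : θ ≤ Real.pi) :
    2 / Real.pi ^ 2 * (Real.pi - θ) ^ 2 ≤ 1 + Real.cos θ := by
  have h := Real.cos_le_one_sub_mul_cos_sq (x := Real.pi - θ)
    (by rw [abs_of_nonneg (by linarith)]; linarith)
  rw [Real.cos_pi_sub] at h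
  linarith

lemma integral_exp_neg_mul_one_add_cos_le {κ : ℝ} (hκ : 0 < κ) :
    ∫ θ in (0 : ℝ)..Real.pi, Real.exp (-κ * (1 + Real.cos θ)) ≤ 4 / √κ := by
  have hπ := Real.pi_pos
  set b := 2 * κ / Real.pi ^ 2 with hb
  have hb0 : 0 < b := by positivity
  have h1 : ∫ θ in (0 : ℝ)..Real.pi, Real.exp (-κ * (1 + Real.cos θ)) ≤
      ∫ θ in (0 : ℝ)..Real.pi, Real.exp (-b * (Real.pi - θ) ^ 2) := by
    refine intervalIntegral.integral_mono_on hπ.le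
      (Continuous.intervalIntegrable (by fun_prop) _ _)
      (Continuous.intervalIntegrable (by fun_prop) _ _) fun θ hθ => ?_
    have := mul_le_mul_of_nonneg_left (two_div_pi_sq_mul_le_one_add_cos hθ.1 hθ.2) hκ.le
    refine Real.exp_le_exp.mpr ?_
    have hbe : b * (Real.pi - θ) ^ 2 = κ * (2 / Real.pi ^ 2 * (Real.pi - θ) ^ 2) := by
      rw [hb]; ring
    linarith
  have h2 : ∫ θ in (0 : ℝ)..Real.pi, Real.exp (-b * (Real.pi - θ) ^ 2) =
      ∫ θ in (0 : ℝ)..Real.pi, Real.exp (-b * θ ^ 2) := by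
    have := intervalIntegral.integral_comp_sub_left (a := 0) (b := Real.pi)
      (fun θ => Real.exp (-b * θ ^ 2)) Real.pi
    simpa using this
  have h3 : ∫ θ in (0 : ℝ)..Real.pi, Real.exp (-b * θ ^ 2) ≤ √(Real.pi / b) := by
    rw [← integral_gaussian, intervalIntegral.integral_of_le hπ.le]
    exact setIntegral_le_integral (integrable_exp_neg_mul_sq hb0)
      (Filter.Eventually.of_forall fun x => (Real.exp_pos _).le)
  have h4 : √(Real.pi / b) ≤ 4 / √κ := by
    rw [show (4 : ℝ) = √16 by rw [show (16 : ℝ) = 4 ^ 2 by norm_num]; simp,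
      ← Real.sqrt_div (by norm_num)]
    refine Real.sqrt_le_sqrt ?_
    rw [hb, div_div_eq_mul_div, div_le_div_iff₀ (by positivity) hκ]
    have h5 : Real.pi ^ 3 ≤ 32 := by
      have : Real.pi ≤ 3.15 := Real.pi_lt_d2.le
      calc Real.pi ^ 3 ≤ 3.15 ^ 3 := by gcongr
        _ ≤ 32 := by norm_num
    nlinarith
  linarith

lemma integral_exp_neg_mul_one_add_cos_mul_sin_sq_le {κ : ℝ} (hκ : 0 < κ) :
    ∫ θ in (0 : ℝ)..Real.pi, Real.exp (-κ * (1 + Real.cos θ)) * Real.sin θ ^ 2 ≤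
      24 / (κ * √κ) := by
  have hπ := Real.pi_pos
  have h1 : ∫ θ in (0 : ℝ)..Real.pi, Real.exp (-κ * (1 + Real.cos θ)) * Real.sin θ ^ 2 ≤
      ∫ θ in (0 : ℝ)..Real.pi, 4 / κ * Real.exp (-(κ / 2) * (1 + Real.cos θ)) := by
    refine intervalIntegral.integral_mono_on hπ.le
      (Continuous.intervalIntegrable (by fun_prop) _ _)
      (Continuous.intervalIntegrable (by fun_prop) _ _) fun θ hθ => ?_
    set u := 1 + Real.cos θ with hu
    have hu0 : 0 ≤ u := by linarith [Real.neg_one_le_cos θ]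
    have hs : Real.sin θ ^ 2 ≤ 2 * u := by
      rw [Real.sin_sq]
      nlinarith [Real.neg_one_le_cos θ, Real.cos_le_one θ]
    have hx : κ / 2 * u ≤ Real.exp (κ / 2 * u) := by
      linarith [Real.add_one_le_exp (κ / 2 * u)]
    have he : Real.exp (-κ * u) = Real.exp (-(κ / 2) * u) * Real.exp (-(κ / 2) * u) := by
      rw [← Real.exp_add]; ring_nf
    have hy : κ / 2 * u * Real.exp (-(κ / 2) * u) ≤ 1 := by
      rw [neg_mul, Real.exp_neg, ← div_eq_mul_inv]
      exact div_le_one_of_le₀ hx (Real.exp_pos _).le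
    calc Real.exp (-κ * u) * Real.sin θ ^ 2 ≤ Real.exp (-κ * u) * (2 * u) := by gcongr
      _ = 4 / κ * (κ / 2 * u * Real.exp (-(κ / 2) * u)) * Real.exp (-(κ / 2) * u) := by
          rw [he]; field_simp; ring
      _ ≤ 4 / κ * 1 * Real.exp (-(κ / 2) * u) := by gcongr
      _ = _ := by ring
  rw [intervalIntegral.integral_const_mul] at h1
  have h2 := integral_exp_neg_mul_one_add_cos_le (half_pos hκ)
  have h3 : 4 / √(κ / 2) ≤ 6 / √κ := by
    rw [div_le_div_iff₀ (by positivity) (by positivity)]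
    have : 2 / 3 * √κ ≤ √(κ / 2) := by
      refine Real.le_sqrt_of_sq_le ?_
      rw [mul_pow, Real.sq_sqrt hκ.le]
      linarith
    linarith
  calc _ ≤ 4 / κ * (6 / √κ) := h1.trans (by gcongr; exact h2.trans h3)
    _ = 24 / (κ * √κ) := by field_simp; norm_num

lemma integral_exp_mul_one_add_cos_le {μ σ : ℝ} (hμ : 0 < μ) (hσ : σ ≤ μ) :
    ∫ θ in (0 : ℝ)..Real.pi, Real.exp (σ * (1 + Real.cos θ)) ≤
      Real.exp (2 + 4 * μ) * (4 / √(1 + |σ|)) := by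
  have h := integral_exp_neg_mul_one_add_cos_le (κ := 1 + |σ|) (by positivity)
  refine le_trans ?_ (mul_le_mul_of_nonneg_left h (Real.exp_pos _).le)
  rw [← intervalIntegral.integral_const_mul]
  refine intervalIntegral.integral_mono_on Real.pi_pos.le
    (Continuous.intervalIntegrable (by fun_prop) _ _)
    (Continuous.intervalIntegrable (by fun_prop) _ _) fun θ _ => ?_
  rw [← Real.exp_add]
  refine Real.exp_le_exp.mpr ?_
  have := mul_le_sub_one_add_abs_mul hμ hσ (u := 1 + Real.cos θ)
    (by linarith [Real.neg_one_le_cos θ]) (by linarith [Real.cos_le_one θ])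
  linarith

lemma exp_mul_sq_le {μ σ : ℝ} (hμ : 0 < μ) (hσ : σ ≤ μ) (θ : ℝ) :
    Real.exp (σ * (1 + Real.cos θ)) ^ 2 ≤
      Real.exp (2 * (2 + 4 * μ)) * Real.exp (-(1 + |σ|) * (1 + Real.cos θ)) := by
  rw [← Real.exp_add, ← Real.exp_nat_mul]
  refine Real.exp_le_exp.mpr ?_
  have hu : 0 ≤ 1 + Real.cos θ := by linarith [Real.neg_one_le_cos θ]
  have := mul_le_sub_one_add_abs_mul hμ hσ hu (by linarith [Real.cos_le_one θ])
  push_cast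
  nlinarith [mul_nonneg (by positivity : 0 ≤ 1 + |σ|) hu]

lemma integral_exp_sq_le {μ σ : ℝ} (hμ : 0 < μ) (hσ : σ ≤ μ) :
    ∫ θ in (0 : ℝ)..Real.pi, Real.exp (σ * (1 + Real.cos θ)) ^ 2 ≤
      Real.exp (2 * (2 + 4 * μ)) * (4 / √(1 + |σ|)) := by
  have h := integral_exp_neg_mul_one_add_cos_le (κ := 1 + |σ|) (by positivity)
  refine le_trans ?_ (mul_le_mul_of_nonneg_left h (Real.exp_pos _).le)
  rw [← intervalIntegral.integral_const_mul]
  exact intervalIntegral.integral_mono_on Real.pi_pos.le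
    (Continuous.intervalIntegrable (by fun_prop) _ _)
    (Continuous.intervalIntegrable (by fun_prop) _ _) fun θ _ => exp_mul_sq_le hμ hσ θ

lemma integral_exp_mul_sin_sq_le {μ σ : ℝ} (hμ : 0 < μ) (hσ : σ ≤ μ) :
    ∫ θ in (0 : ℝ)..Real.pi, (Real.exp (σ * (1 + Real.cos θ)) * Real.sin θ) ^ 2 ≤
      Real.exp (2 * (2 + 4 * μ)) * (24 / ((1 + |σ|) * √(1 + |σ|))) := by
  have h := integral_exp_neg_mul_one_add_cos_mul_sin_sq_le (κ := 1 + |σ|) (by positivity)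
  refine le_trans ?_ (mul_le_mul_of_nonneg_left h (Real.exp_pos _).le)
  rw [← intervalIntegral.integral_const_mul]
  refine intervalIntegral.integral_mono_on Real.pi_pos.le
    (Continuous.intervalIntegrable (by fun_prop) _ _)
    (Continuous.intervalIntegrable (by fun_prop) _ _) fun θ _ => ?_
  rw [mul_pow, ← mul_assoc]
  exact mul_le_mul_of_nonneg_right (exp_mul_sq_le hμ hσ θ) (sq_nonneg _)

/-! ### Estimates for Chebyshev series -/

lemma sq_intervalIntegral_mul_le {f g : ℝ → ℝ} (hf : Continuous f) (hg : Continuous g) {a b : ℝ}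
    (hab : a ≤ b) :
    (∫ x in a..b, f x * g x) ^ 2 ≤ (∫ x in a..b, f x ^ 2) * ∫ x in a..b, g x ^ 2 := by
  have h : ∀ t : ℝ, 0 ≤ (∫ x in a..b, g x ^ 2) * (t * t) +
      (2 * ∫ x in a..b, f x * g x) * t + ∫ x in a..b, f x ^ 2 := by
    intro t
    have h1 : (∫ x in a..b, g x ^ 2) * (t * t) + (2 * ∫ x in a..b, f x * g x) * t +
        (∫ x in a..b, f x ^ 2) = ∫ x in a..b, (f x + t * g x) ^ 2 := by
      have : ∀ x, (f x + t * g x) ^ 2 = (t * t) * g x ^ 2 + (2 * t) * (f x * g x) + f x ^ 2 :=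
        fun x => by ring
      simp_rw [this]
      rw [intervalIntegral.integral_add (Continuous.intervalIntegrable (by fun_prop) _ _)
        (Continuous.intervalIntegrable (by fun_prop) _ _),
        intervalIntegral.integral_add (Continuous.intervalIntegrable (by fun_prop) _ _)
        (Continuous.intervalIntegrable (by fun_prop) _ _), intervalIntegral.integral_const_mul,
        intervalIntegral.integral_const_mul]
      ring
    rw [h1]
    exact intervalIntegral.integral_nonneg hab fun x _ => sq_nonneg _
  have := discrim_le_zero h
  rw [discrim] at this
  nlinarith

lemma norm_cosInt_le (z : ℂ) (q : ℂ[X]) :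
    ‖cosInt z q‖ ≤ ∫ θ in (0 : ℝ)..Real.pi,
      ‖q.eval (Real.cos θ : ℂ)‖ * (Real.exp (z.re * (1 + Real.cos θ)) * Real.sin θ) := by
  refine (intervalIntegral.norm_integral_le_integral_norm Real.pi_pos.le).trans_eq ?_
  refine intervalIntegral.integral_congr_ae (Filter.Eventually.of_forall fun θ hθ => ?_)
  rw [uIoc_of_le Real.pi_pos.le] at hθ
  have hs : 0 ≤ Real.sin θ := Real.sin_nonneg_of_nonneg_of_le_pi hθ.1.le hθ.2
  rw [norm_mul, norm_mul, Complex.norm_exp, Complex.norm_real, Real.norm_of_nonneg hs,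
    Complex.re_ofReal_mul, mul_assoc, mul_comm z.re]

lemma norm_cosInt_sq_le {μ : ℝ} (hμ : 0 < μ) {z : ℂ} (hz : z.re ≤ μ) (q : ℂ[X]) :
    ‖cosInt z q‖ ^ 2 ≤ (∫ θ in (0 : ℝ)..Real.pi, ‖q.eval (Real.cos θ : ℂ)‖ ^ 2) *
      (Real.exp (2 * (2 + 4 * μ)) * (24 / ((1 + |z.re|) * √(1 + |z.re|)))) := by
  have hq := (continuous_eval_cos q).norm
  have h0 : 0 ≤ ∫ θ in (0 : ℝ)..Real.pi, ‖q.eval (Real.cos θ : ℂ)‖ ^ 2 :=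
    intervalIntegral.integral_nonneg Real.pi_pos.le fun _ _ => sq_nonneg _
  refine (pow_le_pow_left₀ (norm_nonneg _) (norm_cosInt_le z q) 2).trans ?_
  refine (sq_intervalIntegral_mul_le hq (by fun_prop) Real.pi_pos.le).trans ?_
  exact mul_le_mul_of_nonneg_left (integral_exp_mul_sin_sq_le hμ hz) h0

lemma norm_cosInt_sq_le' {μ : ℝ} (hμ : 0 < μ) {z : ℂ} (hz : z.re ≤ μ) (q : ℂ[X]) :
    ‖cosInt z q‖ ^ 2 ≤
      (∫ θ in (0 : ℝ)..Real.pi, ‖q.eval (Real.cos θ : ℂ)‖ ^ 2 * Real.sin θ ^ 2) *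
      (Real.exp (2 * (2 + 4 * μ)) * (4 / √(1 + |z.re|))) := by
  have hq := (continuous_eval_cos q).norm
  have h0 : 0 ≤ ∫ θ in (0 : ℝ)..Real.pi, (‖q.eval (Real.cos θ : ℂ)‖ * Real.sin θ) ^ 2 :=
    intervalIntegral.integral_nonneg Real.pi_pos.le fun _ _ => sq_nonneg _
  refine (pow_le_pow_left₀ (norm_nonneg _) (norm_cosInt_le z q) 2).trans ?_
  have h1 : ∀ θ : ℝ, ‖q.eval (Real.cos θ : ℂ)‖ *
      (Real.exp (z.re * (1 + Real.cos θ)) * Real.sin θ) =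
      (‖q.eval (Real.cos θ : ℂ)‖ * Real.sin θ) * Real.exp (z.re * (1 + Real.cos θ)) :=
    fun θ => by ring
  simp_rw [h1, ← mul_pow]
  refine (sq_intervalIntegral_mul_le (hq.mul Real.continuous_sin) (by fun_prop)
    Real.pi_pos.le).trans ?_
  exact mul_le_mul_of_nonneg_left (integral_exp_sq_le hμ hz) h0

lemma norm_eval_derivative_T_mul_sin_le (n : ℕ) (θ : ℝ) :
    ‖(derivative (Chebyshev.T ℂ n)).eval (Real.cos θ : ℂ) * (Real.sin θ : ℂ)‖ ≤ n := by
  have h : (derivative (Chebyshev.T ℂ n)).eval (Real.cos θ : ℂ) * (Real.sin θ : ℂ) =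
      ((n * Real.sin (n * θ) : ℝ) : ℂ) := by
    have h2 := Chebyshev.U_real_cos θ ((n : ℤ) - 1)
    rw [Chebyshev.T_derivative_eq_U, eval_mul, mul_assoc, ← Chebyshev.complex_ofReal_eval_U,
      ← Complex.ofReal_mul, h2]
    simp
  rw [h, Complex.norm_real, norm_mul, Real.norm_natCast, Real.norm_eq_abs]
  exact mul_le_of_le_one_right (Nat.cast_nonneg n) (Real.abs_sin_le_one _)

lemma norm_eval_derivative_U_mul_sin_le (θ : ℝ) (n : ℕ) :
    ‖(derivative (Chebyshev.U ℂ n)).eval (Real.cos θ : ℂ) * (Real.sin θ : ℂ)‖ ≤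
      ((n : ℝ) + 1) ^ 2 := by
  induction n using Nat.twoStepInduction with
  | zero => simp
  | one =>
    have : ‖(Real.sin θ : ℂ)‖ ≤ 1 := by
      rw [Complex.norm_real]; exact Real.abs_sin_le_one θ
    rw [Nat.cast_one, Chebyshev.U_one, show (2 : ℂ[X]) = C 2 from rfl, derivative_C_mul_X, eval_C,
      norm_mul]
    norm_num at this ⊢
    linarith
  | more n ih _ =>
    have h1 := norm_eval_derivative_T_mul_sin_le (n + 2) θ
    have h2 : Chebyshev.U ℂ ((n + 2 : ℕ) : ℤ) =
        C 2 * Chebyshev.T ℂ ((n + 2 : ℕ) : ℤ) + Chebyshev.U ℂ n := by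
      have := Chebyshev.U_eq_two_mul_T_add_U ℂ n
      exact_mod_cast this
    rw [h2, derivative_add, derivative_C_mul, eval_add, eval_mul, eval_C, add_mul, mul_assoc]
    refine (norm_add_le _ _).trans ?_
    rw [norm_mul]
    have h3 : ‖(2 : ℂ)‖ = 2 := by simp
    rw [h3]
    push_cast at h1 ih ⊢
    nlinarith

lemma norm_eval_derivative_derivative_T_mul_sin_le (n : ℕ) (θ : ℝ) :
    ‖(derivative (derivative (Chebyshev.T ℂ n))).eval (Real.cos θ : ℂ) * (Real.sin θ : ℂ)‖ ≤
      (n : ℝ) ^ 3 := by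
  rcases n with _ | n
  · simp
  · have h := norm_eval_derivative_U_mul_sin_le θ n
    rw [Chebyshev.T_derivative_eq_U]
    have h1 : (((n + 1 : ℕ) : ℤ) - 1) = (n : ℤ) := by push_cast; ring
    have h2 : ((((n + 1 : ℕ) : ℤ) : ℂ[X])) = C (((n + 1 : ℕ)) : ℂ) := by simp
    rw [h1, h2, derivative_C_mul, eval_mul, eval_C, mul_assoc, norm_mul, Complex.norm_natCast]
    push_cast at h ⊢
    calc ((n : ℝ) + 1) * _ ≤ ((n : ℝ) + 1) * ((n : ℝ) + 1) ^ 2 := by gcongr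
      _ = _ := by ring

lemma norm_eval_one_derivative_T (n : ℕ) :
    ‖(derivative (Chebyshev.T ℂ n)).eval 1‖ = (n : ℝ) ^ 2 := by
  rw [Chebyshev.T_derivative_eq_U, eval_mul, Chebyshev.U_eval_one]
  simp [sq]

lemma norm_eval_neg_one_derivative_T (n : ℕ) :
    ‖(derivative (Chebyshev.T ℂ n)).eval (-1)‖ = (n : ℝ) ^ 2 := by
  rw [Chebyshev.T_derivative_eq_U, eval_mul, Chebyshev.U_eval_neg_one]
  simp [sq]

lemma norm_eval_T_cos_le (n : ℕ) (θ : ℝ) : ‖(Chebyshev.T ℂ n).eval (Real.cos θ : ℂ)‖ ≤ 1 := by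
  rw [← Chebyshev.complex_ofReal_eval_T, Chebyshev.T_real_cos, Complex.norm_real]
  exact Real.abs_cos_le_one _

lemma norm_cosInt_le_of_norm_mul_sin_le {μ : ℝ} (hμ : 0 < μ) {z : ℂ} (hz : z.re ≤ μ) {q : ℂ[X]}
    {B : ℝ} (hB : ∀ θ : ℝ, ‖q.eval (Real.cos θ : ℂ) * (Real.sin θ : ℂ)‖ ≤ B) :
    ‖cosInt z q‖ ≤ B * (Real.exp (2 + 4 * μ) * (4 / √(1 + |z.re|))) := by
  have hB0 : 0 ≤ B := (norm_nonneg _).trans (hB 0)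
  have hq := (continuous_eval_cos q).norm
  refine (norm_cosInt_le z q).trans ?_
  refine le_trans ?_ (mul_le_mul_of_nonneg_left (integral_exp_mul_one_add_cos_le hμ hz) hB0)
  rw [← intervalIntegral.integral_const_mul]
  refine intervalIntegral.integral_mono_on Real.pi_pos.le
    (Continuous.intervalIntegrable (by fun_prop) _ _)
    (Continuous.intervalIntegrable (by fun_prop) _ _) fun θ _ => ?_
  have h := hB θ
  rw [norm_mul, Complex.norm_real] at h
  have h' : ‖q.eval (Real.cos θ : ℂ)‖ * Real.sin θ ≤ B :=
    (mul_le_mul_of_nonneg_left (le_abs_self _) (norm_nonneg _)).trans h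
  calc _ = ‖q.eval (Real.cos θ : ℂ)‖ * Real.sin θ * Real.exp (z.re * (1 + Real.cos θ)) := by ring
    _ ≤ _ := by gcongr

/-- The constant in the termwise second-order estimate. -/
def termConst (μ : ℝ) : ℝ := 16 * Real.exp (2 + 4 * μ) + 2 * (Real.exp (2 * μ) + 1)

lemma termConst_pos (μ : ℝ) : 0 < termConst μ := by unfold termConst; positivity

/-- Second-order decay in `z` of the quadrature error for a single Chebyshev polynomial. -/
lemma norm_cosInt_T_aliasIndex_sub_le {μ : ℝ} (hμ : 0 < μ) {z : ℂ} (hz : z.re ≤ μ) {L n : ℕ}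
    (hL : 0 < L) (hn : L < n) :
    (1 + ‖z‖) ^ 2 * ‖cosInt z (Chebyshev.T ℂ (aliasIndex L n) - Chebyshev.T ℂ n)‖ ≤
      2 * termConst μ * ((n : ℝ) ^ 2 * (1 + n / √(1 + |z.re|))) := by
  set k := aliasIndex L n with hk
  set q := Chebyshev.T ℂ k - Chebyshev.T ℂ n with hq
  have hkn : (k : ℝ) ≤ n := by exact_mod_cast (aliasIndex_le hL n).trans hn.le
  have hn1 : (1 : ℝ) ≤ n := by exact_mod_cast (Nat.succ_le_of_lt hL).trans hn.le
  have hq1 : q.eval 1 = 0 := by simp [hq]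
  have hq2 : q.eval (-1) = 0 := by
    rw [hq, eval_sub, eval_T_neg_one_aliasIndex hL n, sub_self]
  have e1 := mul_cosInt z q
  have e2 := mul_cosInt z (derivative q)
  rw [hq1, hq2] at e1
  have e3 : z ^ 2 * cosInt z q = -((derivative q).eval 1 * Complex.exp (2 * z)) +
      (derivative q).eval (-1) + cosInt z (derivative (derivative q)) := by
    linear_combination z * e1 - e2
  have b1 : ‖(derivative q).eval 1‖ ≤ 2 * (n : ℝ) ^ 2 := by
    rw [hq, derivative_sub, eval_sub]
    refine (norm_sub_le _ _).trans ?_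
    rw [norm_eval_one_derivative_T, norm_eval_one_derivative_T]
    have : (k : ℝ) ^ 2 ≤ (n : ℝ) ^ 2 := by gcongr
    linarith
  have b2 : ‖(derivative q).eval (-1)‖ ≤ 2 * (n : ℝ) ^ 2 := by
    rw [hq, derivative_sub, eval_sub]
    refine (norm_sub_le _ _).trans ?_
    rw [norm_eval_neg_one_derivative_T, norm_eval_neg_one_derivative_T]
    have : (k : ℝ) ^ 2 ≤ (n : ℝ) ^ 2 := by gcongr
    linarith
  have b3 := norm_cosInt_le_of_norm_mul_sin_le hμ hz (q := derivative (derivative q))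
    (B := 2 * (n : ℝ) ^ 3) fun θ => by
      rw [hq, derivative_sub, derivative_sub, eval_sub, sub_mul]
      refine (norm_sub_le _ _).trans ?_
      have h1 := norm_eval_derivative_derivative_T_mul_sin_le k θ
      have h2 := norm_eval_derivative_derivative_T_mul_sin_le n θ
      have : (k : ℝ) ^ 3 ≤ (n : ℝ) ^ 3 := by gcongr
      linarith
  have b4 := norm_cosInt_le_of_norm_mul_sin_le hμ hz (q := q)
    (B := 2 * (n : ℝ) ^ 3) fun θ => by
      have h1 := norm_eval_T_cos_le k θ
      have h2 := norm_eval_T_cos_le n θ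
      have h3 : ‖(Real.sin θ : ℂ)‖ ≤ 1 := by
        rw [Complex.norm_real]; exact Real.abs_sin_le_one θ
      have h4 : ‖q.eval (Real.cos θ : ℂ)‖ ≤ 2 := by
        rw [hq, eval_sub]
        exact (norm_sub_le _ _).trans (by linarith)
      rw [norm_mul]
      have h5 : (1 : ℝ) ≤ (n : ℝ) ^ 3 := one_le_pow₀ hn1
      calc _ ≤ 2 * (1 : ℝ) := by gcongr
        _ ≤ _ := by linarith
  have b5 : ‖Complex.exp (2 * z)‖ ≤ Real.exp (2 * μ) := by
    rw [Complex.norm_exp]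
    exact Real.exp_le_exp.mpr (by simpa using hz)
  set τ := 1 / √(1 + |z.re|) with hτ
  have hτ0 : 0 ≤ τ := by positivity
  have hE := Real.exp_pos (2 + 4 * μ)
  have hE2 := Real.exp_pos (2 * μ)
  rw [show 4 / √(1 + |z.re|) = 4 * τ by rw [hτ]; ring] at b3 b4
  rw [show (n : ℝ) / √(1 + |z.re|) = n * τ by rw [hτ]; ring]
  have b6 : ‖z‖ ^ 2 * ‖cosInt z q‖ ≤ 2 * (n : ℝ) ^ 2 * Real.exp (2 * μ) + 2 * (n : ℝ) ^ 2 +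
      2 * (n : ℝ) ^ 3 * (Real.exp (2 + 4 * μ) * (4 * τ)) := by
    rw [← norm_pow, ← norm_mul, e3]
    refine (norm_add_le _ _).trans (add_le_add ((norm_add_le _ _).trans (add_le_add ?_ b2)) b3)
    rw [norm_neg, norm_mul]
    gcongr
  have b7 : (1 + ‖z‖) ^ 2 * ‖cosInt z q‖ ≤ 2 * (‖cosInt z q‖ + ‖z‖ ^ 2 * ‖cosInt z q‖) := by
    nlinarith [mul_nonneg (sq_nonneg (1 - ‖z‖)) (norm_nonneg (cosInt z q))]
  refine b7.trans ?_
  have b8 : ‖cosInt z q‖ + ‖z‖ ^ 2 * ‖cosInt z q‖ ≤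
      2 * (Real.exp (2 * μ) + 1) * (n : ℝ) ^ 2 +
        16 * Real.exp (2 + 4 * μ) * ((n : ℝ) ^ 2 * (n * τ)) := by
    calc _ ≤ _ := add_le_add b4 b6
      _ = _ := by ring
  have b9 : 0 ≤ 2 * (Real.exp (2 * μ) + 1) * ((n : ℝ) ^ 2 * (n * τ)) := by positivity
  have b10 : 0 ≤ 16 * Real.exp (2 + 4 * μ) * (n : ℝ) ^ 2 := by positivity
  unfold termConst
  nlinarith

/-! ### The quadrature error for polynomials -/

/-- The square of the weighted norm of the `m`-th derivative of a polynomial. -/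
def polyEnergy (m : ℕ) (p : ℂ[X]) : ℝ :=
  ∫ s in Ioo (0 : ℝ) 2, ‖(derivative^[m] p).eval (s : ℂ)‖ ^ 2 * weight m s

/-- The quadrature error. -/
def quadError (L : ℕ) (z : ℂ) (f : ℝ → ℂ) : ℂ := rule L z f - exactInt z f

lemma continuous_weight {m : ℕ} (hm : 1 ≤ m) : Continuous (weight m) := by
  have h : (0 : ℝ) ≤ (m : ℝ) - 1 / 2 := by
    have : (1 : ℝ) ≤ m := by exact_mod_cast hm
    linarith
  exact (Real.continuous_rpow_const h).comp (by fun_prop)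

lemma weight_nonneg (m : ℕ) {s : ℝ} (hs : s ∈ Icc (0 : ℝ) 2) : 0 ≤ weight m s :=
  Real.rpow_nonneg (mul_nonneg hs.1 (by linarith [hs.2])) _

lemma sin_mul_weight_one_add_cos {m : ℕ} (hm : 1 ≤ m) {θ : ℝ} (hθ : 0 ≤ Real.sin θ) :
    Real.sin θ * weight m (1 + Real.cos θ) = Real.sin θ ^ (2 * m) := by
  have h1 : (1 + Real.cos θ) * (2 - (1 + Real.cos θ)) = Real.sin θ ^ 2 := by
    rw [Real.sin_sq]; ring
  rw [weight, h1]
  rcases hθ.eq_or_lt with h | h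
  · rw [← h, zero_mul, zero_pow (by omega)]
  · rw [← Real.rpow_natCast _ 2, ← Real.rpow_mul h.le, mul_comm]
    nth_rewrite 2 [← Real.rpow_one (Real.sin θ)]
    rw [← Real.rpow_add h, ← Real.rpow_natCast]
    congr 1
    push_cast
    ring

lemma polyEnergy_comp_X_sub_one {m : ℕ} (hm : 1 ≤ m) (P : ℂ[X]) :
    polyEnergy m (P.comp (X - C 1)) = ∫ θ in (0 : ℝ)..Real.pi,
      ‖(derivative^[m] P).eval (Real.cos θ : ℂ)‖ ^ 2 * Real.sin θ ^ (2 * m) := by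
  have hd : derivative^[m] (P.comp (X - C 1)) = (derivative^[m] P).comp (X - C 1) := by
    generalize m = m
    induction m with
    | zero => rfl
    | succ m ih =>
      rw [Function.iterate_succ_apply', ih, derivative_comp, Function.iterate_succ_apply']
      simp
  set Q := derivative^[m] P
  set g : ℝ → ℝ := fun s => ‖(Q.comp (X - C 1)).eval (s : ℂ)‖ ^ 2 * weight m s with hg
  have hgc : Continuous g := by
    have h1 := ((Q.comp (X - C 1)).continuous.comp Complex.continuous_ofReal).norm
    exact (h1.pow 2).mul (continuous_weight hm)
  have h := intervalIntegral.integral_deriv_smul_comp (a := 0) (b := Real.pi)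
    (f := fun θ => 1 + Real.cos θ) (f' := fun θ => -Real.sin θ) (g := g)
    (fun θ _ => by simpa using (Real.hasDerivAt_cos θ).const_add 1)
    (by fun_prop) hgc
  simp only [Real.cos_zero, Real.cos_pi] at h
  norm_num at h
  rw [intervalIntegral.integral_symm 0 2, neg_inj] at h
  rw [polyEnergy, hd, ← integral_Ioc_eq_integral_Ioo,
    ← intervalIntegral.integral_of_le (by norm_num)]
  refine h.symm.trans (intervalIntegral.integral_congr fun θ hθ => ?_)
  rw [uIcc_of_le Real.pi_pos.le] at hθ
  have hs : 0 ≤ Real.sin θ := Real.sin_nonneg_of_nonneg_of_le_pi hθ.1 hθ.2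
  simp only [hg, eval_comp, eval_sub, eval_X, eval_C]
  rw [← sin_mul_weight_one_add_cos hm hs]
  push_cast
  ring_nf

lemma exists_eq_chebSum_comp (p : ℂ[X]) :
    ∃ (N : ℕ) (a : ℕ → ℂ), p = (chebSum (Finset.range N) a).comp (X - C 1) := by
  obtain ⟨N, a, h⟩ := exists_eq_chebSum (p.comp (X + C 1))
  refine ⟨N, a, ?_⟩
  rw [← h, comp_assoc]
  simp

lemma polyEnergy_nonneg (m : ℕ) (p : ℂ[X]) : 0 ≤ polyEnergy m p :=
  setIntegral_nonneg measurableSet_Ioo fun _ hs =>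
    mul_nonneg (sq_nonneg _) (weight_nonneg m (Ioo_subset_Icc_self hs))

lemma sum_filter_lt_pow_mul_norm_sq_le {L m : ℕ} (hm : 1 ≤ m) (hmL : m ≤ L + 1) (s : Finset ℕ)
    (a : ℕ → ℂ) :
    ∑ n ∈ s with L < n, (n : ℝ) ^ (2 * m) * ‖a n‖ ^ 2 ≤
      (m : ℝ) ^ m * polyEnergy m ((chebSum s a).comp (X - C 1)) := by
  rw [polyEnergy_comp_X_sub_one hm]
  refine le_trans (Finset.sum_le_sum_of_subset_of_nonneg (fun n hn => ?_)
    fun n _ _ => by positivity) (sum_pow_mul_norm_sq_le m s a)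
  rw [Finset.mem_filter] at hn ⊢
  exact ⟨hn.1, by omega⟩

/-- The square of the constant in the first-order estimates. -/
def firstConst (m : ℕ) (μ : ℝ) : ℝ :=
  72 * Real.pi * (m : ℝ) ^ m * Real.exp (2 * (2 + 4 * μ))

lemma firstConst_pos {m : ℕ} (hm : 1 ≤ m) (μ : ℝ) : 0 < firstConst m μ := by
  have : (0 : ℝ) < m := by exact_mod_cast hm
  have := Real.pi_pos
  unfold firstConst
  positivity

lemma integral_norm_sq_aliasSum_sub_le {L m : ℕ} (hL : 0 < L) (hm : 1 ≤ m)
    {s : Finset ℕ} (hs : ∀ n ∈ s, L < n) (a : ℕ → ℂ) :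
    ∫ θ in (0 : ℝ)..Real.pi, ‖(aliasSum L s a - chebSum s a).eval (Real.cos θ : ℂ)‖ ^ 2 ≤
      3 * Real.pi * ((L : ℝ) ^ (2 * m))⁻¹ * ∑ n ∈ s, (n : ℝ) ^ (2 * m) * ‖a n‖ ^ 2 := by
  have h := integral_norm_sq_iterate_derivative_chebSum 0 (Finset.range (L + 1) ∪ s)
    (errorCoeff L s a)
  simp only [Function.iterate_zero, id_eq, mul_zero, pow_zero, mul_one, Finset.range_zero,
    Finset.prod_empty, one_mul] at h
  rw [aliasSum_sub_chebSum hL hs, h]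
  have h2 := sum_pow_mul_norm_errorCoeff_sq_le hL hm (Nat.zero_le m) hs a
  simp only [mul_zero, pow_zero, one_mul] at h2
  calc _ ≤ ∑ n ∈ Finset.range (L + 1) ∪ s, ‖errorCoeff L s a n‖ ^ 2 * Real.pi :=
        Finset.sum_le_sum fun n _ => mul_le_mul_of_nonneg_left (chebNormSq_le n) (sq_nonneg _)
    _ = Real.pi * ∑ n ∈ Finset.range (L + 1) ∪ s, ‖errorCoeff L s a n‖ ^ 2 := by
        rw [← Finset.sum_mul, mul_comm]
    _ ≤ Real.pi * _ := mul_le_mul_of_nonneg_left h2 Real.pi_pos.le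
    _ = _ := by ring

lemma integral_norm_sq_derivative_aliasSum_sub_le {L m : ℕ} (hL : 0 < L) (hm : 1 ≤ m)
    {s : Finset ℕ} (hs : ∀ n ∈ s, L < n) (a : ℕ → ℂ) :
    ∫ θ in (0 : ℝ)..Real.pi,
      ‖(derivative (aliasSum L s a - chebSum s a)).eval (Real.cos θ : ℂ)‖ ^ 2 * Real.sin θ ^ 2 ≤
      3 * Real.pi * ((L : ℝ) ^ 2 * ((L : ℝ) ^ (2 * m))⁻¹) *
        ∑ n ∈ s, (n : ℝ) ^ (2 * m) * ‖a n‖ ^ 2 := by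
  have h := integral_norm_sq_iterate_derivative_chebSum 1 (Finset.range (L + 1) ∪ s)
    (errorCoeff L s a)
  simp only [Function.iterate_one, mul_one, Finset.range_one, Finset.prod_singleton,
    Nat.cast_zero, ne_eq, OfNat.ofNat_ne_zero, not_false_eq_true, zero_pow, sub_zero] at h
  rw [aliasSum_sub_chebSum hL hs, h]
  have h2 := sum_pow_mul_norm_errorCoeff_sq_le hL hm hm hs a
  simp only [mul_one] at h2
  calc _ ≤ ∑ n ∈ Finset.range (L + 1) ∪ s, ((n : ℝ) ^ 2 * ‖errorCoeff L s a n‖ ^ 2) * Real.pi :=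
        Finset.sum_le_sum fun n _ => by
          rw [mul_left_comm, ← mul_assoc]
          exact mul_le_mul_of_nonneg_left (chebNormSq_le n) (by positivity)
    _ = Real.pi * ∑ n ∈ Finset.range (L + 1) ∪ s, (n : ℝ) ^ 2 * ‖errorCoeff L s a n‖ ^ 2 := by
        rw [← Finset.sum_mul, mul_comm]
    _ ≤ Real.pi * _ := mul_le_mul_of_nonneg_left h2 Real.pi_pos.le
    _ = _ := by ring

lemma norm_quadError_sq_le_of_polynomial {μ : ℝ} (hμ : 0 < μ) {L m : ℕ} (hL : 0 < L) (hm : 1 ≤ m)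
    (hmL : m ≤ L + 1) {z : ℂ} (hz : z.re ≤ μ) (p : ℂ[X]) :
    ‖quadError L z (fun x : ℝ => p.eval (x : ℂ))‖ ^ 2 ≤
      firstConst m μ * (((L : ℝ) ^ (2 * m))⁻¹ * (1 / ((1 + |z.re|) * √(1 + |z.re|)))) *
        polyEnergy m p := by
  obtain ⟨N, a, rfl⟩ := exists_eq_chebSum_comp p
  set s := Finset.range N
  have h1 := sum_filter_lt_pow_mul_norm_sq_le hm hmL s a
  rw [quadError, rule_sub_exactInt_chebSum hL]
  have h2 := integral_norm_sq_aliasSum_sub_le hL hm (s := s.filter (L < ·))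
    (fun n hn => (Finset.mem_filter.mp hn).2) a
  have hπ := Real.pi_pos
  refine (norm_cosInt_sq_le hμ hz _).trans ?_
  calc _ ≤ (3 * Real.pi * ((L : ℝ) ^ (2 * m))⁻¹ * ((m : ℝ) ^ m *
        polyEnergy m ((chebSum s a).comp (X - C 1)))) *
        (Real.exp (2 * (2 + 4 * μ)) * (24 / ((1 + |z.re|) * √(1 + |z.re|)))) := by
        gcongr
        exact h2.trans (by gcongr)
    _ = _ := by unfold firstConst; ring

lemma norm_mul_norm_quadError_sq_le_of_polynomial {μ : ℝ} (hμ : 0 < μ) {L m : ℕ} (hL : 0 < L)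
    (hm : 1 ≤ m) (hmL : m ≤ L + 1) {z : ℂ} (hz : z.re ≤ μ) (p : ℂ[X]) :
    (‖z‖ * ‖quadError L z (fun x : ℝ => p.eval (x : ℂ))‖) ^ 2 ≤
      firstConst m μ * ((L : ℝ) ^ 2 * ((L : ℝ) ^ (2 * m))⁻¹ * (1 / √(1 + |z.re|))) *
        polyEnergy m p := by
  obtain ⟨N, a, rfl⟩ := exists_eq_chebSum_comp p
  set s := Finset.range N
  have h1 := sum_filter_lt_pow_mul_norm_sq_le hm hmL s a
  rw [quadError, rule_sub_exactInt_chebSum hL]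
  have h2 := integral_norm_sq_derivative_aliasSum_sub_le hL hm (s := s.filter (L < ·))
    (fun n hn => (Finset.mem_filter.mp hn).2) a
  have hπ := Real.pi_pos
  have h3 := mul_cosInt z (aliasSum L (s.filter (L < ·)) a - chebSum (s.filter (L < ·)) a)
  rw [eval_one_aliasSum_sub, eval_neg_one_aliasSum_sub hL, zero_mul, sub_zero, zero_sub] at h3
  rw [← norm_mul, h3, norm_neg]
  refine (norm_cosInt_sq_le' hμ hz _).trans ?_
  have hE := polyEnergy_nonneg m ((chebSum s a).comp (X - C 1))
  calc _ ≤ (3 * Real.pi * ((L : ℝ) ^ 2 * ((L : ℝ) ^ (2 * m))⁻¹) * ((m : ℝ) ^ m *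
        polyEnergy m ((chebSum s a).comp (X - C 1)))) *
        (Real.exp (2 * (2 + 4 * μ)) * (24 / √(1 + |z.re|))) := by
        gcongr
        · exact h2.trans (by gcongr)
        · norm_num
    _ = _ := by unfold firstConst; ring

lemma sum_pow_three_mul_norm_sq_le {L m : ℕ} (hL : 0 < L) (hm : 4 ≤ m) (s : Finset ℕ)
    (hs : ∀ n ∈ s, L < n) (a : ℕ → ℂ) :
    (∑ n ∈ s, (n : ℝ) ^ 3 * ‖a n‖) ^ 2 ≤
      2 * ((L : ℝ) ^ 7 * ((L : ℝ) ^ (2 * m))⁻¹) * ∑ n ∈ s, (n : ℝ) ^ (2 * m) * ‖a n‖ ^ 2 := by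
  have hL' : (0 : ℝ) < L := by exact_mod_cast hL
  have hpos : ∀ n ∈ s, (0 : ℝ) < n := fun n hn => by exact_mod_cast hL.trans (hs n hn)
  have h1 : ∑ n ∈ s, (n : ℝ) ^ 3 * ‖a n‖ =
      ∑ n ∈ s, ((n : ℝ) ^ 3 * ((n : ℝ) ^ m)⁻¹) * ((n : ℝ) ^ m * ‖a n‖) :=
    Finset.sum_congr rfl fun n hn => by
      have := hpos n hn
      field_simp
  have h2 : ∑ n ∈ s, ((n : ℝ) ^ 3 * ((n : ℝ) ^ m)⁻¹) ^ 2 ≤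
      2 * ((L : ℝ) ^ 7 * ((L : ℝ) ^ (2 * m))⁻¹) := by
    have h3 : ∑ n ∈ s, ((n : ℝ) ^ 2)⁻¹ ≤ 2 / L := by
      have hsub : s ⊆ Finset.Ioo L (s.sup id + 1) := fun n hn =>
        Finset.mem_Ioo.mpr ⟨hs n hn, Nat.lt_succ_of_le (Finset.le_sup (f := id) hn)⟩
      refine (Finset.sum_le_sum_of_subset_of_nonneg hsub fun _ _ _ => by positivity).trans ?_
      refine (sum_Ioo_inv_sq_le (α := ℝ) L (s.sup id + 1)).trans ?_
      gcongr
      linarith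
    calc ∑ n ∈ s, ((n : ℝ) ^ 3 * ((n : ℝ) ^ m)⁻¹) ^ 2
        ≤ ∑ n ∈ s, ((L : ℝ) ^ 8 * ((L : ℝ) ^ (2 * m))⁻¹) * ((n : ℝ) ^ 2)⁻¹ := by
          refine Finset.sum_le_sum fun n hn => ?_
          have hn0 := hpos n hn
          have hLn : (L : ℝ) ≤ n := by exact_mod_cast (hs n hn).le
          obtain ⟨i, rfl⟩ := Nat.exists_eq_add_of_le hm
          have e1 : ((n : ℝ) ^ 3 * ((n : ℝ) ^ (4 + i))⁻¹) ^ 2 =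
              ((n : ℝ) ^ (2 * i))⁻¹ * ((n : ℝ) ^ 2)⁻¹ := by
            rw [pow_add, pow_mul', sq ((n : ℝ) ^ i)]
            field_simp
          have e2 : (L : ℝ) ^ 8 * ((L : ℝ) ^ (2 * (4 + i)))⁻¹ = ((L : ℝ) ^ (2 * i))⁻¹ := by
            rw [mul_add, pow_add]
            field_simp
          rw [e1, e2]
          gcongr
      _ = ((L : ℝ) ^ 8 * ((L : ℝ) ^ (2 * m))⁻¹) * ∑ n ∈ s, ((n : ℝ) ^ 2)⁻¹ := by
          rw [Finset.mul_sum]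
      _ ≤ ((L : ℝ) ^ 8 * ((L : ℝ) ^ (2 * m))⁻¹) * (2 / L) := by gcongr
      _ = _ := by field_simp
  rw [h1]
  refine (Finset.sum_mul_sq_le_sq_mul_sq _ _ _).trans ?_
  have h4 : ∑ n ∈ s, ((n : ℝ) ^ m * ‖a n‖) ^ 2 = ∑ n ∈ s, (n : ℝ) ^ (2 * m) * ‖a n‖ ^ 2 :=
    Finset.sum_congr rfl fun n _ => by rw [mul_pow, ← pow_mul, mul_comm m]
  rw [h4]
  gcongr

/-- The square of the constant in the second-order estimate. -/
def secondConst (m : ℕ) (μ : ℝ) : ℝ := 8 * termConst μ ^ 2 * (m : ℝ) ^ m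

lemma secondConst_pos {m : ℕ} (hm : 1 ≤ m) (μ : ℝ) : 0 < secondConst m μ := by
  have : (0 : ℝ) < m := by exact_mod_cast hm
  have := termConst_pos μ
  unfold secondConst
  positivity

lemma one_add_norm_sq_mul_norm_quadError_sq_le_of_polynomial {μ : ℝ} (hμ : 0 < μ) {L m : ℕ}
    (hL : 0 < L) (hm : 4 ≤ m) (hmL : m ≤ L + 1) {z : ℂ} (hz : z.re ≤ μ) (p : ℂ[X]) :
    ((1 + ‖z‖) ^ 2 * ‖quadError L z (fun x : ℝ => p.eval (x : ℂ))‖) ^ 2 ≤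
      secondConst m μ * ((L : ℝ) ^ 5 * ((L : ℝ) ^ (2 * m))⁻¹ * (1 + L / √(1 + |z.re|)) ^ 2) *
        polyEnergy m p := by
  obtain ⟨N, a, rfl⟩ := exists_eq_chebSum_comp p
  set s := Finset.range N
  have hL' : (0 : ℝ) < L := by exact_mod_cast hL
  have h1 := sum_filter_lt_pow_mul_norm_sq_le (by omega) hmL s a
  rw [quadError, rule_sub_exactInt_chebSum hL]
  set t := s.filter (L < ·) with ht
  have hts : ∀ n ∈ t, L < n := fun n hn => (Finset.mem_filter.mp hn).2
  have h2 := sum_pow_three_mul_norm_sq_le hL hm t hts a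
  have hsplit : aliasSum L t a - chebSum t a =
      ∑ n ∈ t, C (a n) * (Chebyshev.T ℂ (aliasIndex L n) - Chebyshev.T ℂ n) := by
    simp only [aliasSum, chebSum, ← Finset.sum_sub_distrib, mul_sub]
  have hτ : 0 ≤ 1 + L / √(1 + |z.re|) := by positivity
  have hT := termConst_pos μ
  have h3 : (1 + ‖z‖) ^ 2 * ‖cosInt z (aliasSum L t a - chebSum t a)‖ ≤
      2 * termConst μ * ((1 + L / √(1 + |z.re|)) / L) * ∑ n ∈ t, (n : ℝ) ^ 3 * ‖a n‖ := by
    rw [hsplit, cosInt_sum, Finset.mul_sum]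
    refine (mul_le_mul_of_nonneg_left (norm_sum_le _ _) (by positivity)).trans ?_
    rw [Finset.mul_sum]
    refine Finset.sum_le_sum fun n hn => ?_
    rw [norm_mul]
    have h4 := norm_cosInt_T_aliasIndex_sub_le hμ hz hL (hts n hn)
    have hLn : (L : ℝ) ≤ n := by exact_mod_cast (hts n hn).le
    have h5 : (n : ℝ) ^ 2 * (1 + n / √(1 + |z.re|)) ≤
        (1 + L / √(1 + |z.re|)) / L * (n : ℝ) ^ 3 := by
      have e : (1 + L / √(1 + |z.re|)) / L * (n : ℝ) ^ 3 =
          (n : ℝ) ^ 2 * (n / L + n / √(1 + |z.re|)) := by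
        field_simp
      rw [e]
      gcongr
      exact (one_le_div hL').mpr hLn
    calc _ = ((1 + ‖z‖) ^ 2 * ‖cosInt z (Chebyshev.T ℂ (aliasIndex L n) - Chebyshev.T ℂ n)‖) *
          ‖a n‖ := by ring
      _ ≤ (2 * termConst μ * ((1 + L / √(1 + |z.re|)) / L * (n : ℝ) ^ 3)) * ‖a n‖ := by
          refine mul_le_mul_of_nonneg_right (h4.trans ?_) (norm_nonneg _)
          gcongr
      _ = _ := by ring
  calc _ ≤ (2 * termConst μ * ((1 + L / √(1 + |z.re|)) / L) *
        ∑ n ∈ t, (n : ℝ) ^ 3 * ‖a n‖) ^ 2 := by gcongr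
    _ = 4 * termConst μ ^ 2 * ((1 + L / √(1 + |z.re|)) / L) ^ 2 *
        (∑ n ∈ t, (n : ℝ) ^ 3 * ‖a n‖) ^ 2 := by ring
    _ ≤ 4 * termConst μ ^ 2 * ((1 + L / √(1 + |z.re|)) / L) ^ 2 *
        (2 * ((L : ℝ) ^ 7 * ((L : ℝ) ^ (2 * m))⁻¹) * ((m : ℝ) ^ m *
        polyEnergy m ((chebSum s a).comp (X - C 1)))) := by
        gcongr
        exact h2.trans (by gcongr)
    _ = _ := by unfold secondConst; field_simp; ring

/-! ### Absolutely continuous complex functions -/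

lemma _root_.AbsolutelyContinuousOnInterval.lipschitz_comp {f : ℝ → ℂ} {a b : ℝ}
    (hf : AbsolutelyContinuousOnInterval f a b) {g : ℂ → ℝ} (hg : ∀ x y, dist (g x) (g y) ≤ dist x y) :
    AbsolutelyContinuousOnInterval (fun x => g (f x)) a b := by
  rw [absolutelyContinuousOnInterval_iff] at hf ⊢
  intro ε hε
  obtain ⟨δ, hδ, h⟩ := hf ε hε
  exact ⟨δ, hδ, fun E hE hlt => (Finset.sum_le_sum fun i _ => hg _ _).trans_lt (h E hE hlt)⟩

lemma _root_.AbsolutelyContinuousOnInterval.complex_re {f : ℝ → ℂ} {a b : ℝ}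
    (hf : AbsolutelyContinuousOnInterval f a b) :
    AbsolutelyContinuousOnInterval (fun x => (f x).re) a b :=
  hf.lipschitz_comp fun x y => by
    rw [Real.dist_eq, ← Complex.sub_re, dist_eq_norm]; exact Complex.abs_re_le_norm _

lemma _root_.AbsolutelyContinuousOnInterval.complex_im {f : ℝ → ℂ} {a b : ℝ}
    (hf : AbsolutelyContinuousOnInterval f a b) :
    AbsolutelyContinuousOnInterval (fun x => (f x).im) a b :=
  hf.lipschitz_comp fun x y => by
    rw [Real.dist_eq, ← Complex.sub_im, dist_eq_norm]; exact Complex.abs_im_le_norm _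

/-- The fundamental theorem of calculus for absolutely continuous complex functions. -/
lemma _root_.AbsolutelyContinuousOnInterval.integral_complex_deriv {f : ℝ → ℂ} {a b : ℝ}
    (hf : AbsolutelyContinuousOnInterval f a b) :
    IntervalIntegrable (deriv f) volume a b ∧ ∫ x in a..b, deriv f x = f b - f a := by
  have hre := hf.complex_re
  have him := hf.complex_im
  have hae : ∀ᵐ x : ℝ, x ∈ uIoc a b → ((deriv (fun x => (f x).re) x : ℝ) : ℂ) +
      ((deriv (fun x => (f x).im) x : ℝ) : ℂ) * Complex.I = deriv f x := by
    filter_upwards [hre.ae_differentiableAt, him.ae_differentiableAt] with x h1 h2 hx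
    have hx' := uIoc_subset_uIcc hx
    have h3 := (h1 hx').hasDerivAt.ofReal_comp.add
      ((h2 hx').hasDerivAt.ofReal_comp.mul_const Complex.I)
    have h4 : (fun y : ℝ => ((f y).re : ℂ)) + (fun y : ℝ => ((f y).im : ℂ) * Complex.I) = f := by
      funext y
      exact Complex.re_add_im (f y)
    rw [h4] at h3
    exact h3.deriv.symm
  have i1 : IntervalIntegrable (fun x => ((deriv (fun x => (f x).re) x : ℝ) : ℂ)) volume a b :=
    ⟨hre.intervalIntegrable_deriv.1.ofReal, hre.intervalIntegrable_deriv.2.ofReal⟩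
  have i2 : IntervalIntegrable (fun x => ((deriv (fun x => (f x).im) x : ℝ) : ℂ) * Complex.I)
      volume a b :=
    ⟨him.intervalIntegrable_deriv.1.ofReal.mul_const _,
      him.intervalIntegrable_deriv.2.ofReal.mul_const _⟩
  constructor
  · exact (i1.add i2).congr_ae ((ae_restrict_iff' measurableSet_uIoc).mpr hae)
  · rw [← intervalIntegral.integral_congr_ae hae, intervalIntegral.integral_add i1 i2,
      intervalIntegral.integral_mul_const, intervalIntegral.integral_ofReal,
      intervalIntegral.integral_ofReal, hre.integral_deriv_eq_sub, him.integral_deriv_eq_sub]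
    apply Complex.ext <;> simp

/-! ### Polynomial approximation -/

lemma exists_polynomial_norm_sub_le {a b : ℝ} {h : ℝ → ℂ} (hh : Continuous h) {ε : ℝ}
    (hε : 0 < ε) : ∃ q : ℂ[X], ∀ x ∈ Icc a b, ‖h x - q.eval (x : ℂ)‖ ≤ ε := by
  obtain ⟨p₁, h₁⟩ := exists_polynomial_near_of_continuousOn a b (fun x => (h x).re)
    (Complex.continuous_re.comp hh).continuousOn (ε / 2) (half_pos hε)
  obtain ⟨p₂, h₂⟩ := exists_polynomial_near_of_continuousOn a b (fun x => (h x).im)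
    (Complex.continuous_im.comp hh).continuousOn (ε / 2) (half_pos hε)
  refine ⟨p₁.map (algebraMap ℝ ℂ) + C Complex.I * p₂.map (algebraMap ℝ ℂ), fun x hx => ?_⟩
  have e : ∀ p : ℝ[X], (p.map (algebraMap ℝ ℂ)).eval (x : ℂ) = ((p.eval x : ℝ) : ℂ) := fun p => by
    rw [eval_map]
    exact eval₂_at_apply (algebraMap ℝ ℂ) x
  rw [eval_add, eval_mul, eval_C, e, e]
  refine (Complex.norm_le_abs_re_add_abs_im _).trans ?_
  have k1 := h₁ x hx
  have k2 := h₂ x hx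
  rw [abs_sub_comm] at k1 k2
  simp only [Complex.sub_re, Complex.add_re, Complex.ofReal_re, Complex.mul_re, Complex.I_re,
    Complex.I_im, Complex.ofReal_im, Complex.sub_im, Complex.add_im, Complex.mul_im]
  norm_num
  linarith

lemma integrable_norm_sq_sub_polynomial {a b : ℝ} {g : ℝ → ℂ}
    (hg : MemLp g 2 (volume.restrict (Icc a b))) (q : ℂ[X]) :
    IntegrableOn (fun x : ℝ => ‖g x - q.eval (x : ℂ)‖ ^ 2) (Icc a b) := by
  have hq : Continuous fun x : ℝ => q.eval (x : ℂ) := q.continuous.comp Complex.continuous_ofReal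
  have hq2 : MemLp (fun x : ℝ => q.eval (x : ℂ)) 2 (volume.restrict (Icc a b)) := by
    rw [memLp_two_iff_integrable_sq_norm hq.aestronglyMeasurable]
    exact (hq.norm.pow 2).continuousOn.integrableOn_Icc
  exact (memLp_two_iff_integrable_sq_norm (hg.sub hq2).1).mp (hg.sub hq2)

lemma exists_polynomial_integral_norm_sub_sq_le {a b : ℝ} (hab : a ≤ b) {g : ℝ → ℂ}
    (hg : MemLp g 2 (volume.restrict (Icc a b))) {ε : ℝ} (hε : 0 < ε) :
    ∃ q : ℂ[X], ∫ x in Icc a b, ‖g x - q.eval (x : ℂ)‖ ^ 2 ≤ ε := by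
  set δ : ℝ := √(ε / (4 * (1 + (b - a)))) with hδ
  have hba : 0 < 1 + (b - a) := by linarith
  have hδ0 : 0 < δ := Real.sqrt_pos.mpr (by positivity)
  have hδ2 : δ ^ 2 = ε / (4 * (1 + (b - a))) := Real.sq_sqrt (by positivity)
  obtain ⟨h, hh, hmem⟩ := hg.exists_boundedContinuous_eLpNorm_sub_le (by norm_num)
    (ε := ENNReal.ofReal δ) (by simpa using hδ0)
  obtain ⟨q, hq⟩ := exists_polynomial_norm_sub_le (a := a) (b := b) h.continuous hδ0
  refine ⟨q, ?_⟩
  have hsub : MemLp (g - (h : ℝ → ℂ)) 2 (volume.restrict (Icc a b)) := hg.sub hmem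
  have h1 : ∫ x in Icc a b, ‖g x - h x‖ ^ 2 ≤ δ ^ 2 := by
    rw [hsub.eLpNorm_eq_integral_rpow_norm (by norm_num) (by norm_num),
      ENNReal.ofReal_le_ofReal_iff hδ0.le] at hh
    have h0 : 0 ≤ ∫ x in Icc a b, ‖g x - h x‖ ^ 2 := integral_nonneg fun _ => sq_nonneg _
    simp only [ENNReal.toReal_ofNat, Real.rpow_ofNat, Pi.sub_apply] at hh
    rw [show (2 : ℝ)⁻¹ = 1 / 2 by norm_num, ← Real.sqrt_eq_rpow] at hh
    exact (Real.sqrt_le_left hδ0.le).mp hh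
  have i1 : IntegrableOn (fun x => ‖g x - h x‖ ^ 2) (Icc a b) :=
    (memLp_two_iff_integrable_sq_norm hsub.1).mp hsub
  have i2 : IntegrableOn (fun _ : ℝ => δ ^ 2) (Icc a b) := integrableOn_const (by simp)
  calc ∫ x in Icc a b, ‖g x - q.eval (x : ℂ)‖ ^ 2
      ≤ ∫ x in Icc a b, (2 * ‖g x - h x‖ ^ 2 + 2 * δ ^ 2) := by
        refine setIntegral_mono_on (integrable_norm_sq_sub_polynomial hg q)
          ((i1.const_mul 2).add (i2.const_mul 2)) measurableSet_Icc fun x hx => ?_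
        have k1 : ‖g x - q.eval (x : ℂ)‖ ≤ ‖g x - h x‖ + δ := by
          calc _ = ‖(g x - h x) + (h x - q.eval (x : ℂ))‖ := by congr 1; ring
            _ ≤ _ := (norm_add_le _ _).trans (by gcongr; exact hq x hx)
        have := pow_le_pow_left₀ (norm_nonneg _) k1 2
        nlinarith [sq_nonneg (‖g x - h x‖ - δ)]
    _ = 2 * (∫ x in Icc a b, ‖g x - h x‖ ^ 2) + 2 * ((b - a) * δ ^ 2) := by
        rw [integral_add (i1.const_mul 2) (i2.const_mul 2), integral_const_mul,
          setIntegral_const]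
        simp [hab]
        ring
    _ ≤ 2 * δ ^ 2 + 2 * ((b - a) * δ ^ 2) := by gcongr
    _ = ε / 2 := by rw [hδ2]; field_simp; ring
    _ ≤ ε := by linarith

lemma exists_derivative_eq (q : ℂ[X]) : ∃ Q : ℂ[X], derivative Q = q := by
  induction q using Polynomial.induction_on' with
  | add p q hp hq =>
    obtain ⟨P, rfl⟩ := hp
    obtain ⟨Q, rfl⟩ := hq
    exact ⟨P + Q, derivative_add⟩
  | monomial n c =>
    refine ⟨monomial (n + 1) (c / (n + 1)), ?_⟩
    rw [derivative_monomial]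
    have : (n : ℂ) + 1 ≠ 0 := by exact_mod_cast n.succ_ne_zero
    simp [div_mul_cancel₀ _ this]

lemma exists_derivative_eq_eval_eq (q : ℂ[X]) (x c : ℂ) :
    ∃ Q : ℂ[X], derivative Q = q ∧ Q.eval x = c := by
  obtain ⟨Q, hQ⟩ := exists_derivative_eq q
  exact ⟨Q + C (c - Q.eval x), by simp [hQ], by simp⟩

lemma hasDerivAt_eval_ofReal (q : ℂ[X]) (x : ℝ) :
    HasDerivAt (fun x : ℝ => q.eval (x : ℂ)) ((derivative q).eval (x : ℂ)) x :=
  (q.hasDerivAt (x : ℂ)).comp_ofReal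

lemma continuous_eval_ofReal (q : ℂ[X]) : Continuous fun x : ℝ => q.eval (x : ℂ) :=
  q.continuous.comp Complex.continuous_ofReal

lemma exists_polynomial_approx_of_absolutelyContinuous {a b : ℝ} (ha : a ≤ 1) (hb : 1 ≤ b)
    (hba : b - a ≤ 2) {f : ℝ → ℂ} (hf : AbsolutelyContinuousOnInterval f a b)
    (hL2 : MemLp (deriv f) 2 (volume.restrict (Icc a b))) {ε : ℝ} (hε : 0 < ε) :
    ∃ q : ℂ[X], (∀ x ∈ Icc a b, ‖f x - q.eval (x : ℂ)‖ ≤ ε) ∧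
      ∫ x in Icc a b, ‖deriv f x - (derivative q).eval (x : ℂ)‖ ^ 2 ≤ ε := by
  set η : ℝ := min ε 1 / 2 with hη
  have hη0 : 0 < η := by positivity
  have hη1 : η ≤ ε / 2 := by rw [hη]; gcongr; exact min_le_left _ _
  have hη2 : η ≤ 1 / 2 := by rw [hη]; gcongr; exact min_le_right _ _
  have hab : a ≤ b := ha.trans hb
  obtain ⟨q, hq⟩ := exists_polynomial_integral_norm_sub_sq_le hab hL2 (pow_pos hη0 2)
  obtain ⟨Q, hQ, hQ1⟩ := exists_derivative_eq_eval_eq q 1 (f 1)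
  refine ⟨Q, fun x hx => ?_, ?_⟩
  · have hsub : uIcc 1 x ⊆ uIcc a b := by
      rw [uIcc_of_le hab]
      exact uIcc_subset_Icc ⟨ha, hb⟩ hx
    obtain ⟨i1, e1⟩ := (hf.mono hsub).integral_complex_deriv
    have hqc := continuous_eval_ofReal q
    have e2 : ∫ t in (1 : ℝ)..x, q.eval (t : ℂ) = Q.eval (x : ℂ) - Q.eval ((1 : ℝ) : ℂ) :=
      intervalIntegral.integral_eq_sub_of_hasDerivAt
        (fun t _ => by simpa [hQ] using hasDerivAt_eval_ofReal Q t) (hqc.intervalIntegrable _ _)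
    have e3 : f x - Q.eval (x : ℂ) = ∫ t in (1 : ℝ)..x, (deriv f t - q.eval (t : ℂ)) := by
      rw [intervalIntegral.integral_sub i1 (hqc.intervalIntegrable _ _), e1, e2,
        Complex.ofReal_one, hQ1]
      ring
    have i2 := integrable_norm_sq_sub_polynomial hL2 q
    have i3 : IntegrableOn (fun _ : ℝ => η) (Icc a b) := integrableOn_const (by simp)
    have hm : AEStronglyMeasurable (fun t : ℝ => deriv f t - q.eval (t : ℂ))
        (volume.restrict (Icc a b)) := hL2.1.sub hqc.aestronglyMeasurable
    have hle : ∀ y : ℝ, 0 ≤ y → y ≤ 1 / 2 * η + 1 / (2 * η) * y ^ 2 := by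
      intro y _
      have : 1 / 2 * η + 1 / (2 * η) * y ^ 2 - y = (y - η) ^ 2 / (2 * η) := by
        field_simp
        ring
      have h2 : 0 ≤ (y - η) ^ 2 / (2 * η) := by positivity
      linarith
    have i4 : IntegrableOn (fun t : ℝ => ‖deriv f t - q.eval (t : ℂ)‖) (Icc a b) := by
      refine ((i3.const_mul (1 / 2)).add (i2.const_mul (1 / (2 * η)))).mono' hm.norm
        (Filter.Eventually.of_forall fun t => ?_)
      rw [norm_norm]
      exact hle _ (norm_nonneg _)
    rw [e3]
    calc ‖∫ t in (1 : ℝ)..x, (deriv f t - q.eval (t : ℂ))‖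
        ≤ ∫ t in uIoc 1 x, ‖deriv f t - q.eval (t : ℂ)‖ :=
          intervalIntegral.norm_integral_le_integral_norm_uIoc
      _ ≤ ∫ t in Icc a b, ‖deriv f t - q.eval (t : ℂ)‖ := by
          refine setIntegral_mono_set i4 (Filter.Eventually.of_forall fun t => norm_nonneg _)
            (LE.le.eventuallyLE ?_)
          exact uIoc_subset_uIcc.trans (by rwa [uIcc_of_le hab] at hsub)
      _ ≤ ∫ t in Icc a b, (1 / 2 * η + 1 / (2 * η) * ‖deriv f t - q.eval (t : ℂ)‖ ^ 2) :=
          setIntegral_mono_on i4 (Integrable.fun_add (i3.const_mul (1 / 2))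
            (i2.const_mul (1 / (2 * η)))) measurableSet_Icc fun t _ => hle _ (norm_nonneg _)
      _ = (b - a) * (1 / 2 * η) +
          1 / (2 * η) * ∫ t in Icc a b, ‖deriv f t - q.eval (t : ℂ)‖ ^ 2 := by
          rw [integral_add (i3.const_mul (1 / 2)) (i2.const_mul (1 / (2 * η))),
            integral_const_mul (1 / (2 * η)), setIntegral_const]
          simp [hab]
      _ ≤ 2 * (1 / 2 * η) + 1 / (2 * η) * η ^ 2 := by gcongr
      _ = 3 / 2 * η := by field_simp; ring
      _ ≤ ε := by linarith
  · rw [hQ]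
    refine hq.trans ?_
    nlinarith

/-- Simultaneous approximation of `f` and its top derivative by a polynomial. -/
lemma exists_polynomial_approx {a b : ℝ} (ha0 : 0 < a) (ha : a ≤ 1) (hb : 1 ≤ b) (hb2 : b < 2)
    (n : ℕ) : ∀ f : ℝ → ℂ, ContDiffOn ℝ (n : WithTop ℕ∞) f (Ioo 0 2) →
    AbsolutelyContinuousOnInterval (iteratedDeriv n f) a b →
    MemLp (iteratedDeriv (n + 1) f) 2 (volume.restrict (Icc a b)) → ∀ ε : ℝ, 0 < ε →
    ∃ q : ℂ[X], (∀ x ∈ Icc a b, ‖f x - q.eval (x : ℂ)‖ ≤ ε) ∧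
      ∫ x in Icc a b, ‖iteratedDeriv (n + 1) f x - (derivative^[n + 1] q).eval (x : ℂ)‖ ^ 2 ≤ ε := by
  induction n with
  | zero =>
    intro f _ hf hL2 ε hε
    rw [iteratedDeriv_zero] at hf
    rw [zero_add, iteratedDeriv_one] at hL2
    simp only [zero_add, iteratedDeriv_one, Function.iterate_one]
    exact exists_polynomial_approx_of_absolutelyContinuous ha hb (by linarith) hf hL2 hε
  | succ n ih =>
    intro f hf hAC hL2 ε hε
    have hf' : ContDiffOn ℝ ((n : WithTop ℕ∞) + 1) f (Ioo 0 2) := by exact_mod_cast hf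
    obtain ⟨hd, -, hf'⟩ := (contDiffOn_succ_iff_deriv_of_isOpen isOpen_Ioo).mp hf'
    rw [iteratedDeriv_succ'] at hAC hL2
    obtain ⟨q, hq1, hq2⟩ := ih (deriv f) hf' hAC hL2 ε hε
    obtain ⟨Q, hQ, hQ1⟩ := exists_derivative_eq_eval_eq q 1 (f 1)
    have hsub : Icc a b ⊆ Ioo 0 2 := fun x hx => ⟨ha0.trans_le hx.1, hx.2.trans_lt hb2⟩
    refine ⟨Q, fun x hx => ?_, ?_⟩
    · have hder : ∀ t ∈ Icc a b, HasDerivAt (fun t : ℝ => f t - Q.eval (t : ℂ))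
          (deriv f t - q.eval (t : ℂ)) t := fun t ht => by
        have h1 := (hd.differentiableAt (isOpen_Ioo.mem_nhds (hsub ht))).hasDerivAt
        have h2 := hasDerivAt_eval_ofReal Q t
        rw [hQ] at h2
        exact h1.sub h2
      have h := (convex_Icc a b).norm_image_sub_le_of_norm_hasDerivWithin_le
        (fun t ht => (hder t ht).hasDerivWithinAt) hq1 ⟨ha, hb⟩ hx
      simp only [Complex.ofReal_one, hQ1, sub_self, sub_zero] at h
      refine h.trans (mul_le_of_le_one_right hε.le ?_)
      rw [Real.norm_eq_abs, abs_le]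
      exact ⟨by linarith [hx.1], by linarith [hx.2]⟩
    · rw [iteratedDeriv_succ', Function.iterate_succ_apply, hQ]
      exact hq2

/-! ### Dilation and passage to admissible functions -/

lemma weight_le_weight_dilate {m : ℕ} (hm : 1 ≤ m) {r s : ℝ} (hr0 : 0 ≤ r) (hr1 : r ≤ 1)
    (hs : s ∈ Icc (0 : ℝ) 2) : weight m s ≤ weight m (r * s + (1 - r)) := by
  have hm' : (1 : ℝ) ≤ m := by exact_mod_cast hm
  refine Real.rpow_le_rpow (mul_nonneg hs.1 (by linarith [hs.2])) ?_ (by linarith)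
  have h2 : 0 ≤ (1 - r ^ 2) * (s - 1) ^ 2 := mul_nonneg (by nlinarith) (sq_nonneg _)
  nlinarith

lemma weight_le_one {m : ℕ} (hm : 1 ≤ m) {s : ℝ} (hs : s ∈ Icc (0 : ℝ) 2) : weight m s ≤ 1 := by
  have hm' : (1 : ℝ) ≤ m := by exact_mod_cast hm
  exact Real.rpow_le_one (mul_nonneg hs.1 (by linarith [hs.2]))
    (by nlinarith [sq_nonneg (s - 1)]) (by linarith)

/-- Dilating a polynomial towards the midpoint decreases its energy. -/
lemma polyEnergy_dilate_le {m : ℕ} (hm : 1 ≤ m) {r : ℝ} (hr0 : 0 < r) (hr1 : r ≤ 1) (q : ℂ[X]) :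
    polyEnergy m (q.comp (C (r : ℂ) * X + C ((1 - r : ℝ) : ℂ))) ≤
      ∫ y in Icc (1 - r) (1 + r), ‖(derivative^[m] q).eval (y : ℂ)‖ ^ 2 * weight m y := by
  have hd : derivative^[m] (q.comp (C (r : ℂ) * X + C ((1 - r : ℝ) : ℂ))) =
      C ((r : ℂ) ^ m) * (derivative^[m] q).comp (C (r : ℂ) * X + C ((1 - r : ℝ) : ℂ)) := by
    generalize m = m
    induction m with
    | zero => simp
    | succ m ih =>
      rw [Function.iterate_succ_apply', ih, derivative_C_mul, derivative_comp,
        Function.iterate_succ_apply', derivative_add, derivative_C_mul_X, derivative_C, add_zero,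
        ← mul_assoc, ← C_mul, pow_succ]
  set Q := derivative^[m] q with hQ
  set G : ℝ → ℝ := fun y => ‖Q.eval (y : ℂ)‖ ^ 2 * weight m y with hG
  have hGc : Continuous G :=
    ((continuous_eval_ofReal Q).norm.pow 2).mul (continuous_weight hm)
  have h1 : ∫ s in (0 : ℝ)..2, r * G (r * s + (1 - r)) = ∫ y in (1 - r)..(1 + r), G y := by
    rw [intervalIntegral.integral_const_mul, intervalIntegral.integral_comp_mul_add _ hr0.ne',
      smul_eq_mul, mul_inv_cancel_left₀ hr0.ne']
    congr 1 <;> ring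
  rw [integral_Icc_eq_integral_Ioc, ← intervalIntegral.integral_of_le (by linarith), ← h1,
    intervalIntegral.integral_of_le (by norm_num), integral_Ioc_eq_integral_Ioo, polyEnergy, hd]
  have hGr : Continuous fun s : ℝ => r * G (r * s + (1 - r)) := by fun_prop
  set P := C ((r : ℂ) ^ m) * Q.comp (C (r : ℂ) * X + C ((1 - r : ℝ) : ℂ)) with hP
  have hc : Continuous fun s : ℝ => ‖P.eval (s : ℂ)‖ ^ 2 * weight m s :=
    ((continuous_eval_ofReal P).norm.pow 2).mul (continuous_weight hm)
  refine setIntegral_mono_on (hc.continuousOn.integrableOn_Icc.mono_set Ioo_subset_Icc_self)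
    (hGr.continuousOn.integrableOn_Icc.mono_set Ioo_subset_Icc_self) measurableSet_Ioo
    fun s hs => ?_
  have hs' := Ioo_subset_Icc_self hs
  have e : P.eval (s : ℂ) = (r : ℂ) ^ m * Q.eval ((r * s + (1 - r) : ℝ) : ℂ) := by
    simp [hP]
  have hw := weight_le_weight_dilate hm hr0.le hr1 hs'
  have hw0 := weight_nonneg m hs'
  have hrm : (r ^ m) ^ 2 ≤ r := by
    rw [← pow_mul]
    exact pow_le_of_le_one hr0.le hr1 (by omega)
  simp only [hG]
  rw [e, norm_mul, norm_pow, Complex.norm_real, Real.norm_of_nonneg hr0.le, mul_pow, mul_assoc]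
  gcongr

lemma IsAdmissible.memLp {m : ℕ} (hm : 1 ≤ m) {f : ℝ → ℂ} (hf : IsAdmissible m f) {r : ℝ}
    (hr0 : 0 < r) (hr1 : r < 1) :
    MemLp (iteratedDeriv m f) 2 (volume.restrict (Icc (1 - r) (1 + r))) := by
  obtain ⟨n, rfl⟩ := Nat.exists_eq_add_of_le' hm
  have hmeas : StronglyMeasurable (iteratedDeriv (n + 1) f) := by
    rw [iteratedDeriv_succ]
    exact stronglyMeasurable_deriv _
  rw [memLp_two_iff_integrable_sq_norm hmeas.aestronglyMeasurable]
  set c : ℝ := (1 - r ^ 2) ^ (((n + 1 : ℕ) : ℝ) - 1 / 2) with hc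
  have hr2 : 0 < 1 - r ^ 2 := by nlinarith
  have hc0 : 0 < c := Real.rpow_pos_of_pos hr2 _
  have hsub : Icc (1 - r) (1 + r) ⊆ Ioo (0 : ℝ) 2 := fun x hx =>
    ⟨by linarith [hx.1], by linarith [hx.2]⟩
  refine ((hf.integrable.mono_set hsub).const_mul c⁻¹).mono'
    (hmeas.norm.pow 2).aestronglyMeasurable ?_
  refine (ae_restrict_iff' measurableSet_Icc).mpr (Filter.Eventually.of_forall fun x hx => ?_)
  have hw : c ≤ weight (n + 1) x := by
    refine Real.rpow_le_rpow hr2.le ?_ (by push_cast; linarith [(Nat.cast_nonneg n : (0 : ℝ) ≤ n)])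
    nlinarith [hx.1, hx.2]
  rw [Real.norm_of_nonneg (sq_nonneg _), ← div_eq_inv_mul, le_div_iff₀ hc0]
  gcongr

/-- Density of polynomials: an admissible function is a uniform limit of polynomials whose energies
are asymptotically at most that of the function. -/
lemma IsAdmissible.exists_polynomial {m : ℕ} (hm : 1 ≤ m) {f : ℝ → ℂ} (hf : IsAdmissible m f)
    {ε : ℝ} (hε : 0 < ε) :
    ∃ p : ℂ[X], (∀ x ∈ Icc (0 : ℝ) 2, ‖f x - p.eval (x : ℂ)‖ ≤ ε) ∧
      polyEnergy m p ≤ (∫ s in Ioo (0 : ℝ) 2, ‖iteratedDeriv m f s‖ ^ 2 * weight m s) + ε := by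
  set W := ∫ s in Ioo (0 : ℝ) 2, ‖iteratedDeriv m f s‖ ^ 2 * weight m s with hW
  have hW0 : 0 ≤ W := setIntegral_nonneg measurableSet_Ioo fun s hs =>
    mul_nonneg (sq_nonneg _) (weight_nonneg m (Ioo_subset_Icc_self hs))
  obtain ⟨δ, hδ, hunif⟩ := Metric.uniformContinuousOn_iff.mp
    (isCompact_Icc.uniformContinuousOn_of_continuous hf.continuousOn) (ε / 2) (half_pos hε)
  set r : ℝ := 1 - min δ 1 / 2 with hr
  have hmin : 0 < min δ 1 := by positivity
  have hr0 : 0 < r := by linarith [min_le_right δ 1]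
  have hr1 : r < 1 := by linarith
  have hrδ : 1 - r < δ := by linarith [min_le_left δ 1]
  set t : ℝ := ε / (2 * (W + 1)) with ht
  have ht0 : 0 < t := by positivity
  have htW : t * W ≤ ε / 2 := by
    rw [ht, div_mul_eq_mul_div, div_le_div_iff₀ (by positivity) (by norm_num)]
    nlinarith
  set η : ℝ := ε / (2 * (1 + 1 / t)) with hη
  have hη0 : 0 < η := by positivity
  have hηt : (1 + 1 / t) * η = ε / 2 := by rw [hη]; field_simp
  have hηε : η ≤ ε / 2 := by
    rw [← hηt]
    have : 0 < 1 / t * η := by positivity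
    linarith
  have hmem := hf.memLp hm hr0 hr1
  obtain ⟨n, rfl⟩ := Nat.exists_eq_add_of_le' hm
  obtain ⟨q, hq1, hq2⟩ := exists_polynomial_approx (a := 1 - r) (b := 1 + r) (by linarith)
    (by linarith) (by linarith) (by linarith) n f (by simpa using hf.contDiffOn)
    (by simpa using hf.absCont (1 - r) (1 + r) (by linarith) (by linarith) (by linarith))
    hmem η hη0
  refine ⟨q.comp (C (r : ℂ) * X + C ((1 - r : ℝ) : ℂ)), fun x hx => ?_, ?_⟩
  · have e : (q.comp (C (r : ℂ) * X + C ((1 - r : ℝ) : ℂ))).eval (x : ℂ) =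
        q.eval ((r * x + (1 - r) : ℝ) : ℂ) := by simp
    have hy : r * x + (1 - r) ∈ Icc (1 - r) (1 + r) := ⟨by nlinarith [hx.1], by nlinarith [hx.2]⟩
    have hy2 : r * x + (1 - r) ∈ Icc (0 : ℝ) 2 := ⟨by linarith [hy.1], by linarith [hy.2]⟩
    have hdist : dist x (r * x + (1 - r)) < δ := by
      rw [Real.dist_eq, show x - (r * x + (1 - r)) = (1 - r) * (x - 1) by ring, abs_mul,
        abs_of_pos (by linarith : 0 < 1 - r)]
      have : |x - 1| ≤ 1 := abs_le.mpr ⟨by linarith [hx.1], by linarith [hx.2]⟩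
      nlinarith
    have h1 := hunif x hx _ hy2 hdist
    rw [dist_eq_norm] at h1
    have h2 := hq1 _ hy
    rw [e]
    calc _ = ‖(f x - f (r * x + (1 - r))) +
          (f (r * x + (1 - r)) - q.eval ((r * x + (1 - r) : ℝ) : ℂ))‖ := by congr 1; ring
      _ ≤ ε / 2 + ε / 2 := (norm_add_le _ _).trans (add_le_add h1.le (h2.trans hηε))
      _ = ε := by ring
  · refine (polyEnergy_dilate_le hm hr0 hr1.le q).trans ?_
    have hsub : Icc (1 - r) (1 + r) ⊆ Ioo (0 : ℝ) 2 := fun x hx =>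
      ⟨by linarith [hx.1], by linarith [hx.2]⟩
    have i1 := hf.integrable.mono_set hsub
    have i2 := integrable_norm_sq_sub_polynomial hmem (derivative^[n + 1] q)
    have hc : Continuous fun y : ℝ =>
        ‖(derivative^[n + 1] q).eval (y : ℂ)‖ ^ 2 * weight (n + 1) y :=
      ((continuous_eval_ofReal _).norm.pow 2).mul (continuous_weight hm)
    calc _ ≤ ∫ y in Icc (1 - r) (1 + r),
          ((1 + t) * (‖iteratedDeriv (n + 1) f y‖ ^ 2 * weight (n + 1) y) + (1 + 1 / t) *
          ‖iteratedDeriv (n + 1) f y - (derivative^[n + 1] q).eval (y : ℂ)‖ ^ 2) := by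
          refine setIntegral_mono_on hc.continuousOn.integrableOn_Icc
            ((i1.const_mul _).add (i2.const_mul _)) measurableSet_Icc fun y hy => ?_
          have hy' := Ioo_subset_Icc_self (hsub hy)
          have hw0 := weight_nonneg (n + 1) hy'
          have hw1 := weight_le_one hm hy'
          set u := (derivative^[n + 1] q).eval (y : ℂ)
          set v := iteratedDeriv (n + 1) f y
          have h1 : ‖u‖ ≤ ‖v‖ + ‖v - u‖ := by
            calc ‖u‖ = ‖v - (v - u)‖ := by congr 1; ring
              _ ≤ _ := norm_sub_le _ _
          have h2 : (‖v‖ + ‖v - u‖) ^ 2 ≤ (1 + t) * ‖v‖ ^ 2 + (1 + 1 / t) * ‖v - u‖ ^ 2 := by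
            have e : (1 + t) * ‖v‖ ^ 2 + (1 + 1 / t) * ‖v - u‖ ^ 2 - (‖v‖ + ‖v - u‖) ^ 2 =
                (t * ‖v‖ - ‖v - u‖) ^ 2 / t := by
              field_simp
              ring
            have : 0 ≤ (t * ‖v‖ - ‖v - u‖) ^ 2 / t := by positivity
            linarith
          have h3 : ‖u‖ ^ 2 ≤ (1 + t) * ‖v‖ ^ 2 + (1 + 1 / t) * ‖v - u‖ ^ 2 :=
            (pow_le_pow_left₀ (norm_nonneg _) h1 2).trans h2
          calc ‖u‖ ^ 2 * weight (n + 1) y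
              ≤ ((1 + t) * ‖v‖ ^ 2 + (1 + 1 / t) * ‖v - u‖ ^ 2) * weight (n + 1) y := by gcongr
            _ = (1 + t) * (‖v‖ ^ 2 * weight (n + 1) y) +
                (1 + 1 / t) * ‖v - u‖ ^ 2 * weight (n + 1) y := by ring
            _ ≤ _ := add_le_add le_rfl (mul_le_of_le_one_right (by positivity) hw1)
      _ = (1 + t) * (∫ y in Icc (1 - r) (1 + r),
            ‖iteratedDeriv (n + 1) f y‖ ^ 2 * weight (n + 1) y) +
          (1 + 1 / t) * ∫ y in Icc (1 - r) (1 + r),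
            ‖iteratedDeriv (n + 1) f y - (derivative^[n + 1] q).eval (y : ℂ)‖ ^ 2 := by
          rw [integral_add (i1.const_mul _) (i2.const_mul _), integral_const_mul,
            integral_const_mul]
      _ ≤ (1 + t) * W + (1 + 1 / t) * η := by
          gcongr
          refine setIntegral_mono_set hf.integrable ?_ (LE.le.eventuallyLE hsub)
          refine (ae_restrict_iff' measurableSet_Ioo).mpr (Filter.Eventually.of_forall fun x hx => ?_)
          exact mul_nonneg (sq_nonneg _) (weight_nonneg _ (Ioo_subset_Icc_self hx))
      _ ≤ W + ε := by rw [hηt]; linarith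

/-! ### Continuity of the quadrature error -/

lemma node_mem_Icc (L ℓ : ℕ) : node L ℓ ∈ Icc (0 : ℝ) 2 :=
  ⟨by unfold node; linarith [Real.neg_one_le_cos (ℓ * Real.pi / L)],
    by unfold node; linarith [Real.cos_le_one (ℓ * Real.pi / L)]⟩

/-- The weights of the product quadrature rule. -/
def ruleWeight (L : ℕ) (z : ℂ) (ℓ : ℕ) : ℂ :=
  ∫ s in (0 : ℝ)..2, (Lagrange.basis (Finset.range (L + 1)) (fun ℓ => (node L ℓ : ℂ)) ℓ).eval
    (s : ℂ) * Complex.exp (s * z)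

lemma rule_eq_sum (L : ℕ) (z : ℂ) (f : ℝ → ℂ) :
    rule L z f = ∑ ℓ ∈ Finset.range (L + 1), f (node L ℓ) * ruleWeight L z ℓ := by
  have he : Continuous fun s : ℝ => Complex.exp (s * z) := by fun_prop
  simp only [rule, ruleWeight, interp, Lagrange.interpolate_apply]
  simp_rw [← intervalIntegral.integral_const_mul]
  rw [← intervalIntegral.integral_finsetSum]
  · refine intervalIntegral.integral_congr fun s _ => ?_
    simp only [eval_finsetSum, eval_mul, eval_C, Finset.sum_mul, mul_assoc]
  · intro ℓ _
    exact (((continuous_eval_ofReal _).mul he).const_mul _).intervalIntegrable _ _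

lemma exists_norm_quadError_sub_le (L : ℕ) (z : ℂ) :
    ∃ M : ℝ, 0 ≤ M ∧ ∀ f g : ℝ → ℂ, ContinuousOn f (Icc 0 2) → ContinuousOn g (Icc 0 2) →
      ∀ ε : ℝ, (∀ x ∈ Icc (0 : ℝ) 2, ‖f x - g x‖ ≤ ε) →
        ‖quadError L z f - quadError L z g‖ ≤ M * ε := by
  have he : Continuous fun s : ℝ => Complex.exp (s * z) := by fun_prop
  refine ⟨(∑ ℓ ∈ Finset.range (L + 1), ‖ruleWeight L z ℓ‖) +
    ∫ s in (0 : ℝ)..2, ‖Complex.exp (s * z)‖, ?_, fun f g hf hg ε hfg => ?_⟩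
  · exact add_nonneg (Finset.sum_nonneg fun _ _ => norm_nonneg _)
      (intervalIntegral.integral_nonneg (by norm_num) fun _ _ => norm_nonneg _)
  · have h1 : ‖rule L z f - rule L z g‖ ≤
        (∑ ℓ ∈ Finset.range (L + 1), ‖ruleWeight L z ℓ‖) * ε := by
      rw [rule_eq_sum, rule_eq_sum, ← Finset.sum_sub_distrib, Finset.sum_mul]
      refine (norm_sum_le _ _).trans (Finset.sum_le_sum fun ℓ _ => ?_)
      rw [← sub_mul, norm_mul, mul_comm]
      gcongr
      exact hfg _ (node_mem_Icc L ℓ)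
    have h2 : ‖exactInt z f - exactInt z g‖ ≤
        (∫ s in (0 : ℝ)..2, ‖Complex.exp (s * z)‖) * ε := by
      have k : ∀ f : ℝ → ℂ, ContinuousOn f (Icc 0 2) →
          IntervalIntegrable (fun s : ℝ => f s * Complex.exp (s * z)) volume 0 2 := fun f hf =>
        ContinuousOn.intervalIntegrable (by
          rw [uIcc_of_le (by norm_num)]
          exact hf.mul he.continuousOn)
      rw [exactInt, exactInt, ← intervalIntegral.integral_sub (k f hf) (k g hg),
        ← intervalIntegral.integral_mul_const]
      refine intervalIntegral.norm_integral_le_of_norm_le (by norm_num)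
        (Filter.Eventually.of_forall fun s hs => ?_)
        ((he.norm.mul_const ε).intervalIntegrable _ _)
      rw [← sub_mul, norm_mul, mul_comm]
      gcongr
      exact hfg _ (Ioc_subset_Icc_self hs)
    calc ‖quadError L z f - quadError L z g‖ =
          ‖(rule L z f - rule L z g) - (exactInt z f - exactInt z g)‖ := by
          unfold quadError; congr 1; ring
      _ ≤ _ := (norm_sub_le _ _).trans ((add_le_add h1 h2).trans_eq (by ring))

/-- A bound of the quadrature error by the energy extends from polynomials to admissible
functions. -/
lemma IsAdmissible.mul_norm_quadError_le {m L : ℕ} (hm : 1 ≤ m) {z : ℂ} {c K : ℝ} (hc : 0 ≤ c)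
    (hp : ∀ p : ℂ[X], (c * ‖quadError L z (fun x : ℝ => p.eval (x : ℂ))‖) ^ 2 ≤
      K * polyEnergy m p) (hK : 0 ≤ K) {f : ℝ → ℂ} (hf : IsAdmissible m f) :
    c * ‖quadError L z f‖ ≤ √K * weightedNorm m (iteratedDeriv m f) := by
  obtain ⟨M, hM, hcont⟩ := exists_norm_quadError_sub_le L z
  set W := ∫ s in Ioo (0 : ℝ) 2, ‖iteratedDeriv m f s‖ ^ 2 * weight m s with hW
  have hbound : ∀ ε : ℝ, 0 < ε → c * ‖quadError L z f‖ ≤ √(K * (W + ε)) + c * (M * ε) := by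
    intro ε hε
    obtain ⟨p, hp1, hp2⟩ := hf.exists_polynomial hm hε
    have h1 := hcont f (fun x : ℝ => p.eval (x : ℂ)) hf.continuousOn
      (continuous_eval_ofReal p).continuousOn ε hp1
    have h2 : c * ‖quadError L z (fun x : ℝ => p.eval (x : ℂ))‖ ≤ √(K * (W + ε)) :=
      Real.le_sqrt_of_sq_le ((hp p).trans (by gcongr))
    have h3 : ‖quadError L z f‖ ≤ ‖quadError L z (fun x : ℝ => p.eval (x : ℂ))‖ + M * ε := by
      have := norm_sub_norm_le (quadError L z f) (quadError L z (fun x : ℝ => p.eval (x : ℂ)))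
      linarith
    calc c * ‖quadError L z f‖
        ≤ c * (‖quadError L z (fun x : ℝ => p.eval (x : ℂ))‖ + M * ε) := by gcongr
      _ ≤ _ := by rw [mul_add]; gcongr
  have hlim : Filter.Tendsto (fun ε : ℝ => √(K * (W + ε)) + c * (M * ε))
      (nhdsWithin 0 (Ioi 0)) (nhds (√(K * (W + 0)) + c * (M * 0))) := by
    have : Continuous fun ε : ℝ => √(K * (W + ε)) + c * (M * ε) := by fun_prop
    exact (this.tendsto 0).mono_left nhdsWithin_le_nhds
  have h := ge_of_tendsto hlim (eventually_nhdsWithin_of_forall fun ε hε => hbound ε hε)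
  simpa [weightedNorm, Real.sqrt_mul hK] using h

lemma sq_rpow_one_sub_natCast {L : ℕ} (hL : 0 < L) (m : ℕ) :
    ((L : ℝ) ^ (1 - (m : ℝ))) ^ 2 = (L : ℝ) ^ 2 * ((L : ℝ) ^ (2 * m))⁻¹ := by
  have hL' : (0 : ℝ) < L := by exact_mod_cast hL
  rw [Real.rpow_sub hL', Real.rpow_one, Real.rpow_natCast, div_pow, ← pow_mul, mul_comm m,
    div_eq_mul_inv]

lemma sq_rpow_neg_three_quarters {κ : ℝ} (hκ : 0 < κ) :
    (κ ^ (-(3 / 4) : ℝ)) ^ 2 = 1 / (κ * √κ) := by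
  rw [← Real.rpow_natCast, ← Real.rpow_mul hκ.le, one_div, Real.sqrt_eq_rpow]
  nth_rewrite 2 [← Real.rpow_one κ]
  rw [← Real.rpow_add hκ, ← Real.rpow_neg hκ.le]
  norm_num

/-- The estimate of first order in `1 / z`. -/
theorem norm_quadError_le {μ : ℝ} (hμ : 0 < μ) {L m : ℕ} (hL : 0 < L) (hm : 1 ≤ m)
    (hmL : m ≤ L + 1) {z : ℂ} (hz : z.re ≤ μ) {f : ℝ → ℂ} (hf : IsAdmissible m f) :
    ‖quadError L z f‖ ≤ √(firstConst m μ) * (L : ℝ) ^ (1 - (m : ℝ)) *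
      (1 + |z.re|) ^ (-(3 / 4) : ℝ) *
      (if z = 0 then 1 / (L : ℝ) else min (1 / (L : ℝ)) (1 / ‖z‖ * (1 + |z.re|) ^ (1 / 2 : ℝ))) *
      weightedNorm m (iteratedDeriv m f) := by
  have hL' : (0 : ℝ) < L := by exact_mod_cast hL
  have hκ : 0 < 1 + |z.re| := by positivity
  have hN : 0 ≤ weightedNorm m (iteratedDeriv m f) := Real.sqrt_nonneg _
  have hC := firstConst_pos hm μ
  set κ := 1 + |z.re| with hκdef
  set B := √(firstConst m μ) * (L : ℝ) ^ (1 - (m : ℝ)) * κ ^ (-(3 / 4) : ℝ) with hB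
  have hB0 : 0 ≤ B := by positivity
  have hB2 : B ^ 2 = firstConst m μ * ((L : ℝ) ^ 2 * ((L : ℝ) ^ (2 * m))⁻¹) * (1 / (κ * √κ)) := by
    rw [hB, mul_pow, mul_pow, Real.sq_sqrt hC.le, sq_rpow_one_sub_natCast hL,
      sq_rpow_neg_three_quarters hκ]
  have h1 : ‖quadError L z f‖ ≤ B * (1 / L) * weightedNorm m (iteratedDeriv m f) := by
    have h := hf.mul_norm_quadError_le hm (c := 1) zero_le_one
      (fun p => by
        rw [one_mul]
        exact norm_quadError_sq_le_of_polynomial hμ hL hm hmL hz p)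
      (by positivity)
    rw [one_mul] at h
    refine h.trans (mul_le_mul_of_nonneg_right (Real.sqrt_le_iff.mpr ⟨by positivity, ?_⟩) hN)
    rw [mul_pow, hB2, ← hκdef]
    refine le_of_eq ?_
    field_simp
  split_ifs with hz0
  · exact h1
  · have hz' : 0 < ‖z‖ := norm_pos_iff.mpr hz0
    have h2 : ‖quadError L z f‖ ≤
        B * (1 / ‖z‖ * κ ^ (1 / 2 : ℝ)) * weightedNorm m (iteratedDeriv m f) := by
      have h := hf.mul_norm_quadError_le hm (norm_nonneg z)
        (fun p => norm_mul_norm_quadError_sq_le_of_polynomial hμ hL hm hmL hz p) (by positivity)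
      have h3 : √(firstConst m μ * ((L : ℝ) ^ 2 * ((L : ℝ) ^ (2 * m))⁻¹ * (1 / √κ))) ≤
          B * κ ^ (1 / 2 : ℝ) := by
        refine Real.sqrt_le_iff.mpr ⟨by positivity, le_of_eq ?_⟩
        rw [mul_pow, hB2, ← Real.sqrt_eq_rpow, Real.sq_sqrt hκ.le]
        field_simp
      have h4 := h.trans (mul_le_mul_of_nonneg_right h3 hN)
      calc ‖quadError L z f‖ ≤ (B * κ ^ (1 / 2 : ℝ) * weightedNorm m (iteratedDeriv m f)) / ‖z‖ := by
            rw [le_div_iff₀ hz', mul_comm]; exact h4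
        _ = _ := by ring
    rcases min_choice (1 / (L : ℝ)) (1 / ‖z‖ * κ ^ (1 / 2 : ℝ)) with h | h <;> rw [h]
    exacts [h1, h2]

/-- The estimate of second order in `1 / z`. -/
theorem norm_quadError_le_second_order {μ : ℝ} (hμ : 0 < μ) {L m : ℕ} (hL : 0 < L) (hm : 4 ≤ m)
    {m₀ : ℝ} (hm₀ : 7 / 2 < m₀) (hmL : m ≤ L + 1) {z : ℂ} (hz : z.re ≤ μ) {f : ℝ → ℂ}
    (hf : IsAdmissible m f) :
    ‖quadError L z f‖ ≤ √(secondConst m μ) * (1 + ‖z‖) ^ (-2 : ℝ) *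
      (L : ℝ) ^ (m₀ - (m : ℝ) - 1) * (1 + (1 + |z.re|) ^ (-(1 / 2) : ℝ) * (L : ℝ)) *
      weightedNorm m (iteratedDeriv m f) := by
  have hL' : (0 : ℝ) < L := by exact_mod_cast hL
  have hL1 : (1 : ℝ) ≤ L := by exact_mod_cast hL
  have hκ : 0 < 1 + |z.re| := by positivity
  have hz1 : 0 < 1 + ‖z‖ := by positivity
  have hN : 0 ≤ weightedNorm m (iteratedDeriv m f) := Real.sqrt_nonneg _
  have hC := secondConst_pos (by omega : 1 ≤ m) μ
  have h := hf.mul_norm_quadError_le (by omega) (by positivity)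
    (fun p => one_add_norm_sq_mul_norm_quadError_sq_le_of_polynomial hμ hL hm hmL hz p)
    (by positivity)
  have hτ : (1 + |z.re|) ^ (-(1 / 2) : ℝ) * (L : ℝ) = L / √(1 + |z.re|) := by
    rw [Real.rpow_neg hκ.le, ← Real.sqrt_eq_rpow, inv_mul_eq_div]
  have hz2 : (1 + ‖z‖) ^ (-2 : ℝ) = ((1 + ‖z‖) ^ 2)⁻¹ := by
    rw [Real.rpow_neg hz1.le, Real.rpow_ofNat]
  rw [hτ, hz2]
  have hpow : (L : ℝ) ^ 5 * ((L : ℝ) ^ (2 * m))⁻¹ ≤ ((L : ℝ) ^ (m₀ - (m : ℝ) - 1)) ^ 2 := by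
    have e : (L : ℝ) ^ 5 * ((L : ℝ) ^ (2 * m))⁻¹ = ((L : ℝ) ^ (5 / 2 - (m : ℝ))) ^ 2 := by
      rw [← Real.rpow_natCast ((L : ℝ) ^ (5 / 2 - (m : ℝ))), ← Real.rpow_mul hL'.le,
        ← Real.rpow_natCast (L : ℝ) 5, ← Real.rpow_natCast (L : ℝ) (2 * m),
        ← Real.rpow_neg hL'.le, ← Real.rpow_add hL']
      congr 1
      push_cast
      ring
    rw [e]
    refine pow_le_pow_left₀ (by positivity) ?_ 2
    exact Real.rpow_le_rpow_of_exponent_le hL1 (by linarith)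
  have h3 : √(secondConst m μ * ((L : ℝ) ^ 5 * ((L : ℝ) ^ (2 * m))⁻¹ *
      (1 + L / √(1 + |z.re|)) ^ 2)) ≤
      √(secondConst m μ) * ((L : ℝ) ^ (m₀ - (m : ℝ) - 1) * (1 + L / √(1 + |z.re|))) := by
    refine Real.sqrt_le_iff.mpr ⟨by positivity, ?_⟩
    rw [mul_pow, Real.sq_sqrt hC.le, mul_pow]
    gcongr
  have h4 := h.trans (mul_le_mul_of_nonneg_right h3 hN)
  calc ‖quadError L z f‖ ≤ (√(secondConst m μ) * ((L : ℝ) ^ (m₀ - (m : ℝ) - 1) *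
        (1 + L / √(1 + |z.re|))) * weightedNorm m (iteratedDeriv m f)) / (1 + ‖z‖) ^ 2 := by
        rw [le_div_iff₀ (by positivity), mul_comm]; exact h4
    _ = _ := by ring

end

end ClenshawCurtis

theorem theorem3p1 :
    (∀ μ₀ : ℝ, 0 < μ₀ → ∀ m : ℕ, 1 ≤ m →
      ∃ C : ℝ, 0 < C ∧
        ∀ L : ℕ, 1 ≤ L → m ≤ L + 1 →
        ∀ z : ℂ, z.re ≤ μ₀ →
        ∀ f : ℝ → ℂ, ClenshawCurtis.IsAdmissible m f →
          ‖ClenshawCurtis.rule L z f - ClenshawCurtis.exactInt z f‖ ≤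
            C * (L : ℝ) ^ (1 - (m : ℝ)) * (1 + |z.re|) ^ (-(3 / 4) : ℝ) *
              -- for `z = 0` the second term of the minimum is infinite
              (if z = 0 then 1 / (L : ℝ)
                else min (1 / (L : ℝ)) (1 / ‖z‖ * (1 + |z.re|) ^ (1 / 2 : ℝ))) *
              ClenshawCurtis.weightedNorm m (iteratedDeriv m f)) ∧
    (∀ μ₀ : ℝ, 0 < μ₀ → ∀ (m : ℕ) (m₀ : ℝ), 7 / 2 < m₀ → m₀ ≤ m →
      ∃ C' : ℝ, 0 < C' ∧
        ∀ L : ℕ, 1 ≤ L → m ≤ L + 1 →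
        ∀ z : ℂ, z.re ≤ μ₀ →
        ∀ f : ℝ → ℂ, ClenshawCurtis.IsAdmissible m f →
          ‖ClenshawCurtis.rule L z f - ClenshawCurtis.exactInt z f‖ ≤
            C' * (1 + ‖z‖) ^ (-2 : ℝ) * (L : ℝ) ^ (m₀ - (m : ℝ) - 1) *
              (1 + (1 + |z.re|) ^ (-(1 / 2) : ℝ) * (L : ℝ)) *
              ClenshawCurtis.weightedNorm m (iteratedDeriv m f)) := by
  refine ⟨fun μ₀ hμ m hm => ?_, fun μ₀ hμ m m₀ hm₀ hm => ?_⟩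
  · exact ⟨_, Real.sqrt_pos.mpr (ClenshawCurtis.firstConst_pos hm μ₀),
      fun L hL hmL z hz f hf => ClenshawCurtis.norm_quadError_le hμ hL hm hmL hz hf⟩
  · have hm4 : 4 ≤ m := by
      have h : (3 : ℝ) < m := by linarith
      exact_mod_cast h
    exact ⟨_, Real.sqrt_pos.mpr (ClenshawCurtis.secondConst_pos (by omega : 1 ≤ m) μ₀),
      fun L hL hmL z hz f hf =>
        ClenshawCurtis.norm_quadError_le_second_order hμ hL hm4 hm₀ hmL hz hf⟩
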